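/- Let $\mathbb K\in\{\mathbb R,\mathbb C\}$, $n\ge 1$, and let $F\in\mathbb K^{n\times n}$, $G\in\mathbb K^{n\times m}$, $H\in\mathbb K^{p\times n}$ be such that $F$ is stable (all its eigenvalues lie in the open unit disc) and $(F,G,H)$ is minimal ($(F,G)$ controllable and $(F,H)$ observable). A bounded block Toeplitz operator $A:\ell^2(\mathbb Z;\mathbb K^m)\to\ell^2(\mathbb Z;\mathbb K^p)$ with blocks $A_{i-j}$ is causal if $A_k=0$ for $k<0$, strictly anticausal if $A_k=0$ for $k\ge0$, and has transfer function $A(z)=\sum_k A_kz^{-k}$, $|z|=1$; $\|\cdot\|$ is the operator norm and $*$ the conjugate transpose. The transfer function $T(z)=H(z^{-1}I-F)^{-1}G$ is that of a bounded strictly anticausal block Toeplitz operator $T$. The Lyapunov equations $$Z=F^*ZF+H^*H,\qquad \Pi=F\Pi F^*+GG^*$$ have unique solutions $Z$, $\Pi$; the product $Z\Pi$ has only real eigenvalues, its largest eigenvalue $\lambda_{\max}(Z\Pi)$ is positive, and $$\min_{L\ \text{causal, bounded, block Toeplitz}}\|L-T\|^2=\lambda_{\max}(Z\Pi),$$ the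 minimum being attained. Moreover, put $\gamma^2=\lambda_{\max}(Z\Pi)$ and let $Z_\gamma$ be the unique solution of $Z_\gamma=F^*Z_\gamma F+\gamma^{-2}H^*H$. If the matrix $I-F^*Z_\gamma F\Pi$ is invertible, then with $$K_\gamma=(I-F^*Z_\gamma F\Pi)^{-1}F^*Z_\gamma G,\qquad F_\gamma=F^*-K_\gamma G^*,$$ the function $$L(z)=H\Pi\bigl(I+F_\gamma(zI-F_\gamma)^{-1}\bigr)K_\gamma$$ is the transfer function of a bounded causal block Toeplitz operator $L$ that attains the minimum, $\|L-T\|^2=\gamma^2$. -/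

import Mathlib

open scoped Matrix ENNReal

noncomputable section

namespace Nehari

/-- Doubly-infinite square-summable sequences with values in the Euclidean space `𝕜^m`. -/
abbrev Signal (𝕜 : Type*) [RCLike 𝕜] (m : ℕ) : Type _ :=
  lp (fun _ : ℤ => EuclideanSpace 𝕜 (Fin m)) 2

/-- Bounded operators between doubly-infinite `ℓ²` signal spaces (with their operator norm). -/
abbrev Op (𝕜 : Type*) [RCLike 𝕜] (m p : ℕ) : Type _ :=
  Signal 𝕜 m →L[𝕜] Signal 𝕜 p

/-- The `(i, j)` block of an operator: the response at time `i` to an impulse at time `j`. -/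
def block {𝕜 : Type*} [RCLike 𝕜] {m p : ℕ} (A : Op 𝕜 m p) (i j : ℤ) :
    Matrix (Fin p) (Fin m) 𝕜 :=
  Matrix.of fun a b => (A (lp.single 2 j (EuclideanSpace.single b (1 : 𝕜)))) i a

/-- The blocks are constant along the block diagonals. -/
def IsBlockToeplitz {𝕜 : Type*} [RCLike 𝕜] {m p : ℕ} (A : Op 𝕜 m p) : Prop :=
  ∀ i j : ℤ, block A (i + 1) (j + 1) = block A i j

/-- Causal: block lower triangular. -/
def IsCausal {𝕜 : Type*} [RCLike 𝕜] {m p : ℕ} (A : Op 𝕜 m p) : Prop :=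
  ∀ i j : ℤ, i < j → block A i j = 0

/-- Strictly anticausal: strictly block upper triangular. -/
def IsStrictlyAnticausal {𝕜 : Type*} [RCLike 𝕜] {m p : ℕ} (A : Op 𝕜 m p) : Prop :=
  ∀ i j : ℤ, j ≤ i → block A i j = 0

/-- A matrix over `𝕜` (that is, `ℝ` or `ℂ`) regarded as a complex matrix. -/
def toC {𝕜 : Type*} [RCLike 𝕜] {k l : ℕ} (M : Matrix (Fin k) (Fin l) 𝕜) :
    Matrix (Fin k) (Fin l) ℂ :=
  M.map (RCLike.map 𝕜 ℂ)

/-- `A` is block Toeplitz and `Φ(z) = ∑ₖ Aₖ z⁻ᵏ` on the unit circle, where `Aₖ` is the block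
of `A` on the `k`-th diagonal. -/
def HasTransferFunction {𝕜 : Type*} [RCLike 𝕜] {m p : ℕ} (A : Op 𝕜 m p)
    (Φ : ℂ → Matrix (Fin p) (Fin m) ℂ) : Prop :=
  IsBlockToeplitz A ∧
    ∀ z : ℂ, ‖z‖ = 1 → HasSum (fun k : ℤ => z ^ (-k) • toC (block A k 0)) (Φ z)

/-- All complex eigenvalues lie in the open unit disc. -/
def IsStable {𝕜 : Type*} [RCLike 𝕜] {n : ℕ} (F : Matrix (Fin n) (Fin n) 𝕜) : Prop :=
  ∀ μ ∈ spectrum ℂ (toC F), ‖μ‖ < 1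

/-- The matrix `[G, FG, …, Fⁿ⁻¹G]` has full row rank. -/
def IsControllable {𝕜 : Type*} [RCLike 𝕜] {n m : ℕ}
    (F : Matrix (Fin n) (Fin n) 𝕜) (G : Matrix (Fin n) (Fin m) 𝕜) : Prop :=
  (Matrix.of fun (i : Fin n) (kj : Fin n × Fin m) => (F ^ (kj.1 : ℕ) * G) i kj.2).rank = n

/-- The matrix with block rows `H, HF, …, HFⁿ⁻¹` has full column rank. -/
def IsObservable {𝕜 : Type*} [RCLike 𝕜] {n p : ℕ}
    (F : Matrix (Fin n) (Fin n) 𝕜) (H : Matrix (Fin p) (Fin n) 𝕜) : Prop :=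
  (Matrix.of fun (ki : Fin n × Fin p) (j : Fin n) => (H * F ^ (ki.1 : ℕ)) ki.2 j).rank = n

/-- A realization is minimal when it is controllable and observable. -/
def IsMinimal {𝕜 : Type*} [RCLike 𝕜] {n m p : ℕ} (F : Matrix (Fin n) (Fin n) 𝕜)
    (G : Matrix (Fin n) (Fin m) 𝕜) (H : Matrix (Fin p) (Fin n) 𝕜) : Prop :=
  IsControllable F G ∧ IsObservable F H

/-- `A` has only real eigenvalues and `lam` is the largest of them. -/
def IsMaxEigenvalue {𝕜 : Type*} [RCLike 𝕜] {n : ℕ} (A : Matrix (Fin n) (Fin n) 𝕜)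
    (lam : ℝ) : Prop :=
  (∀ μ ∈ spectrum ℂ (toC A), μ.im = 0) ∧
    IsGreatest {x : ℝ | (x : ℂ) ∈ spectrum ℂ (toC A)} lam

/-- `T(z) = H (z⁻¹ I - F)⁻¹ G`. -/
def anticausalTransfer {𝕜 : Type*} [RCLike 𝕜] {n m p : ℕ} (F : Matrix (Fin n) (Fin n) 𝕜)
    (G : Matrix (Fin n) (Fin m) 𝕜) (H : Matrix (Fin p) (Fin n) 𝕜) (z : ℂ) :
    Matrix (Fin p) (Fin m) ℂ :=
  toC H * (z⁻¹ • (1 : Matrix (Fin n) (Fin n) ℂ) - toC F)⁻¹ * toC G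

/-- `K_γ = (I - F* Z_γ F Π)⁻¹ F* Z_γ G`. -/
def gainK {𝕜 : Type*} [RCLike 𝕜] {n m : ℕ} (F : Matrix (Fin n) (Fin n) 𝕜)
    (G : Matrix (Fin n) (Fin m) 𝕜) (P Zg : Matrix (Fin n) (Fin n) 𝕜) :
    Matrix (Fin n) (Fin m) 𝕜 :=
  (1 - Fᴴ * Zg * F * P)⁻¹ * Fᴴ * Zg * G

/-- `F_γ = F* - K_γ G*`. -/
def stateF {𝕜 : Type*} [RCLike 𝕜] {n m : ℕ} (F : Matrix (Fin n) (Fin n) 𝕜)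
    (G : Matrix (Fin n) (Fin m) 𝕜) (P Zg : Matrix (Fin n) (Fin n) 𝕜) :
    Matrix (Fin n) (Fin n) 𝕜 :=
  Fᴴ - gainK F G P Zg * Gᴴ

/-- `L(z) = H Π (I + F_γ (z I - F_γ)⁻¹) K_γ`. -/
def solutionTransfer {𝕜 : Type*} [RCLike 𝕜] {n m p : ℕ} (F : Matrix (Fin n) (Fin n) 𝕜)
    (G : Matrix (Fin n) (Fin m) 𝕜) (H : Matrix (Fin p) (Fin n) 𝕜)
    (P Zg : Matrix (Fin n) (Fin n) 𝕜) (z : ℂ) : Matrix (Fin p) (Fin m) ℂ :=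
  toC H * toC P *
    (1 + toC (stateF F G P Zg) *
      (z • (1 : Matrix (Fin n) (Fin n) ℂ) - toC (stateF F G P Zg))⁻¹) *
    toC (gainK F G P Zg)

end Nehari

end

open scoped Matrix ENNReal

noncomputable section

namespace Nehari

open scoped ComplexOrder

variable {𝕜 : Type*} [RCLike 𝕜]

/-! Realize `T` by the backward recursion ξ(i-1) = Fξ(i) + Gu(i) with output Hξ(i).

Lower bound (`le_norm_error_sq`): the inputs u(j) = G*F*ʲw, j ≥ 0, steer ξ(-1) to Πw with energy
w*Πw, and the output of `T` at negative times then has energy (Πw)*Z(Πw). A causal `L` responds with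
nothing at negative times, so ‖L - T‖² w*Πw ≥ w*ΠZΠw; taking w an eigenvector of ZΠ for its largest
eigenvalue gives the bound.

Upper bound (`norm_error_sq_le`): at level c, put Z_c = c⁻¹Z and let `L` be the forward recursion
with matrix F_γ, state η and output HΠη. A quadratic storage function of (ξ, η), of no definite
sign, satisfies |error|² ≤ c(|u|² + increment of storage) (`dissipation`). Summing over time
telescopes, and the storage vanishes at both ends because F and F_γ are stable
(`norm_lt_one_of_mem_spectrum_state`). This needs only Z_c ≤ Π⁻¹, which `exists_isMaxEigenvalue`
supplies down to the optimal level, and invertibility of I - F*Z_cFΠ.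

Strictly above the optimal level that invertibility is automatic; at the level itself it may fail,
so attainment in general comes from a weak limit of suboptimal solutions (`exists_optimal`). -/

/-- The canonical map from `𝕜` to `ℂ` as a ring homomorphism. -/
def complexHom (𝕜 : Type*) [RCLike 𝕜] : 𝕜 →+* ℂ where
  toFun := RCLike.map 𝕜 ℂ
  map_one' := by simp [RCLike.map_apply]
  map_zero' := by simp
  map_add' := map_add (RCLike.map 𝕜 ℂ)
  map_mul' x y := by
    apply Complex.ext <;> simp [RCLike.map_apply]

theorem complexHom_apply (x : 𝕜) : complexHom 𝕜 x = RCLike.map 𝕜 ℂ x := rfl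

theorem complexHom_star (x : 𝕜) : complexHom 𝕜 (star x) = star (complexHom 𝕜 x) := by
  apply Complex.ext <;> simp [RCLike.map_apply, complexHom_apply]

theorem complexHom_ofReal (x : ℝ) : complexHom 𝕜 (x : 𝕜) = (x : ℂ) := by
  simp [RCLike.map_apply, complexHom_apply]

theorem norm_complexHom (x : 𝕜) : ‖complexHom 𝕜 x‖ = ‖x‖ := by
  rw [← sq_eq_sq₀ (norm_nonneg _) (norm_nonneg _), RCLike.norm_sq_eq_def, RCLike.norm_sq_eq_def]
  simp [RCLike.map_apply, complexHom_apply]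

/-! ### Complexification of real or complex matrices. -/

section toC

variable {k l r : ℕ}

theorem toC_eq_map (A : Matrix (Fin k) (Fin l) 𝕜) : toC A = A.map (complexHom 𝕜) := rfl

theorem toC_apply (A : Matrix (Fin k) (Fin l) 𝕜) (i : Fin k) (j : Fin l) :
    toC A i j = complexHom 𝕜 (A i j) := rfl

theorem toC_injective : Function.Injective (toC : Matrix (Fin k) (Fin l) 𝕜 → _) :=
  Matrix.map_injective (complexHom 𝕜).injective

theorem toC_mul (A : Matrix (Fin k) (Fin l) 𝕜) (B : Matrix (Fin l) (Fin r) 𝕜) :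
    toC (A * B) = toC A * toC B := by
  simp only [toC_eq_map, Matrix.map_mul]

theorem toC_add (A B : Matrix (Fin k) (Fin l) 𝕜) : toC (A + B) = toC A + toC B := by
  ext; simp [toC_apply]

theorem toC_sub (A B : Matrix (Fin k) (Fin l) 𝕜) : toC (A - B) = toC A - toC B := by
  ext; simp [toC_apply]

theorem toC_zero : toC (0 : Matrix (Fin k) (Fin l) 𝕜) = 0 := by
  ext; simp [toC_apply]

theorem toC_one : toC (1 : Matrix (Fin k) (Fin k) 𝕜) = 1 := by
  ext i j; by_cases h : i = j <;> simp [toC_apply, Matrix.one_apply, h]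

theorem toC_pow (A : Matrix (Fin k) (Fin k) 𝕜) (N : ℕ) : toC (A ^ N) = toC A ^ N := by
  induction N with
  | zero => simp [toC_one]
  | succ N ih => rw [pow_succ, pow_succ, toC_mul, ih]

theorem toC_smul (c : ℝ) (A : Matrix (Fin k) (Fin l) 𝕜) : toC (c • A) = c • toC A := by
  ext; simp [toC_apply, RCLike.real_smul_eq_coe_mul, complexHom_ofReal]

theorem toC_conjTranspose (A : Matrix (Fin k) (Fin l) 𝕜) : toC Aᴴ = (toC A)ᴴ := by
  ext; simp only [toC_apply, Matrix.conjTranspose_apply, complexHom_star]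

theorem isUnit_toC {A : Matrix (Fin k) (Fin k) 𝕜} (h : IsUnit A) : IsUnit (toC A) := by
  obtain ⟨B, h1, h2⟩ := isUnit_iff_exists.1 h
  exact isUnit_iff_exists.2 ⟨toC B, by rw [← toC_mul, h1, toC_one], by rw [← toC_mul, h2, toC_one]⟩

end toC

/-! ### Unconditional sums of matrices. -/

section summable

variable {ι : Type*} {k l r s : ℕ}

/-- Reduces to entrywise absolute values, so summability passes between `𝕜` and `ℂ`, and survives
unimodular factors, without fixing a matrix norm. -/
theorem summable_matrix_iff {a : ι → Matrix (Fin k) (Fin l) 𝕜} :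
    Summable a ↔ ∀ i j, Summable fun x => ‖a x i j‖ := by
  simp only [summable_norm_iff]
  exact (Pi.summable (f := a)).trans (forall_congr' fun i => Pi.summable)

theorem summable_toC_iff {a : ι → Matrix (Fin k) (Fin l) 𝕜} :
    (Summable fun x => toC (a x)) ↔ Summable a := by
  simp only [summable_matrix_iff, toC_apply, norm_complexHom]

theorem hasSum_mul_left {a : ι → Matrix (Fin k) (Fin l) 𝕜} {S : Matrix (Fin k) (Fin l) 𝕜}
    (B : Matrix (Fin r) (Fin k) 𝕜) (h : HasSum a S) : HasSum (fun x => B * a x) (B * S) :=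
  h.map (AddMonoidHom.mk' (fun M : Matrix (Fin k) (Fin l) 𝕜 => B * M) (Matrix.mul_add B))
    (continuous_const.matrix_mul continuous_id)

theorem hasSum_mul_right {a : ι → Matrix (Fin k) (Fin l) 𝕜} {S : Matrix (Fin k) (Fin l) 𝕜}
    (B : Matrix (Fin l) (Fin r) 𝕜) (h : HasSum a S) : HasSum (fun x => a x * B) (S * B) :=
  h.map (AddMonoidHom.mk' (fun M : Matrix (Fin k) (Fin l) 𝕜 => M * B)
    (fun M N => Matrix.add_mul M N B)) (continuous_id.matrix_mul continuous_const)

/-- The sum of the geometric series of a matrix, when it converges, inverts `1 - A`. -/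
theorem one_sub_mul_of_hasSum_pow {A S : Matrix (Fin k) (Fin k) 𝕜}
    (hS : HasSum (fun N : ℕ => A ^ N) S) : (1 - A) * S = 1 := by
  have h1 : HasSum (fun N : ℕ => A ^ (N + 1)) (A * S) := by
    simpa only [pow_succ'] using hasSum_mul_left A hS
  have h2 := ((hasSum_nat_add_iff' (f := fun N : ℕ => A ^ N) 1).2 hS).unique h1
  rw [Finset.range_one, Finset.sum_singleton, pow_zero] at h2
  rw [sub_mul, one_mul, ← h2]
  abel

theorem summable_mul_mul {a : ι → Matrix (Fin k) (Fin l) 𝕜} (h : Summable a)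
    (B : Matrix (Fin r) (Fin k) 𝕜) (C : Matrix (Fin l) (Fin s) 𝕜) :
    Summable fun x => B * a x * C :=
  let ⟨_, hS⟩ := h
  (hasSum_mul_right C (hasSum_mul_left B hS)).summable

end summable

/-! ### Powers of a stable matrix. -/

section stable

variable {n : ℕ}

attribute [local instance] Matrix.linftyOpNormedRing Matrix.linftyOpNormedAlgebra

/-- Gelfand's formula: the spectral radius is below some q < 1, so ‖Aᵏ‖ ≤ qᵏ eventually. -/
theorem summable_pow_complex {A : Matrix (Fin n) (Fin n) ℂ}
    (h : ∀ μ ∈ spectrum ℂ A, ‖μ‖ < 1) : Summable fun k : ℕ => A ^ k := by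
  rcases Nat.eq_zero_or_pos n with rfl | hn
  · have : ∀ k : ℕ, A ^ k = 0 := fun k => Subsingleton.elim _ _
    simp only [this]; exact summable_zero
  have : Nonempty (Fin n) := ⟨⟨0, hn⟩⟩
  have hr : spectralRadius ℂ A < 1 := by
    have := spectrum.spectralRadius_lt_of_forall_lt (r := 1) A (fun k hk => by
      simpa [← NNReal.coe_lt_coe] using h k hk)
    simpa using this
  obtain ⟨q, hq1, hq2⟩ := ENNReal.lt_iff_exists_nnreal_btwn.1 hr
  have hlim := spectrum.pow_nnnorm_pow_one_div_tendsto_nhds_spectralRadius A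
  have hev : ∀ᶠ k : ℕ in Filter.atTop, ‖A ^ k‖ ≤ (q : ℝ) ^ k := by
    filter_upwards [hlim.eventually (gt_mem_nhds hq1), Filter.eventually_gt_atTop 0] with k hk hk0
    have h1 : (‖A ^ k‖₊ : ℝ≥0∞) ≤ (q : ℝ≥0∞) ^ k := by
      have := ENNReal.rpow_le_rpow hk.le (z := k) (by positivity)
      rwa [← ENNReal.rpow_mul, one_div, inv_mul_cancel₀ (by positivity), ENNReal.rpow_one,
        ENNReal.rpow_natCast] at this
    have h2 : ‖A ^ k‖₊ ≤ q ^ k := by exact_mod_cast h1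
    exact_mod_cast h2
  have hq : (q : ℝ) < 1 := by exact_mod_cast hq2
  exact Summable.of_norm_bounded_eventually_nat (summable_geometric_of_lt_one q.2 hq) hev

end stable

theorem IsStable.summable_pow {n : ℕ} {F : Matrix (Fin n) (Fin n) 𝕜} (h : IsStable F) :
    Summable fun k : ℕ => F ^ k := by
  rw [← summable_toC_iff]
  simpa only [toC_pow] using summable_pow_complex h

theorem summable_pow_smul {n : ℕ} {A : Matrix (Fin n) (Fin n) ℂ} (h : Summable fun k : ℕ => A ^ k)
    {z : ℂ} (hz : ‖z‖ = 1) : Summable fun k : ℕ => (z • A) ^ k := by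
  rw [summable_matrix_iff] at h ⊢
  intro i j
  simpa [smul_pow, hz] using h i j

/-! ### Uniqueness of Fourier coefficients. -/

/-- A trigonometric series vanishing identically on the unit circle has zero coefficients. -/
theorem eq_zero_of_hasSum_zpow {d : ℤ → ℂ}
    (h : ∀ z : ℂ, ‖z‖ = 1 → HasSum (fun k : ℤ => z ^ (-k) * d k) 0) : d = 0 := by
  -- Convergence at z = 1 alone already yields absolute summability, hence uniform convergence on
  -- the circle; the coefficients are then recovered in L² by orthonormality.
  have hd : Summable fun k => ‖d k‖ := by
    have := (h 1 (by simp)).summable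
    simpa using this.norm
  have hsum : Summable fun k : ℤ => d k • (fourier (-k) : C(UnitAddCircle, ℂ)) := by
    refine Summable.of_norm ?_
    refine hd.congr fun k => ?_
    rw [norm_smul, fourier_norm, mul_one]
  have hzero : HasSum (fun k : ℤ => d k • (fourier (-k) : C(UnitAddCircle, ℂ))) 0 := by
    obtain ⟨g, hg⟩ := hsum
    have : g = 0 := by
      ext x
      have h1 := ContinuousMap.hasSum_apply hg x
      have h2 := h (fourier 1 x) (by rw [fourier_one]; exact Circle.norm_coe _)
      refine h1.unique ?_
      rw [ContinuousMap.zero_apply]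
      convert h2 using 2 with k
      rw [ContinuousMap.smul_apply, smul_eq_mul, mul_comm, fourier_one, fourier_apply,
        AddCircle.toCircle_zsmul, Circle.coe_zpow]
    rwa [this] at hg
  have hL : HasSum (fun k : ℤ => d k • (fourierLp (T := 1) 2 (-k))) 0 := by
    have := hzero.mapL (ContinuousMap.toLp (E := ℂ) 2 AddCircle.haarAddCircle ℂ)
    simpa [fourierLp] using this
  funext j
  have h1 := hL.mapL (innerSL ℂ (fourierLp (T := 1) 2 (-j)))
  simp only [innerSL_apply_apply, inner_smul_right, map_zero,
    orthonormal_iff_ite.1 (orthonormal_fourier (T := 1)), neg_inj] at h1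
  have h2 := hasSum_ite_eq j (d j)
  have h3 : (fun k => d k * if j = k then 1 else 0) = fun k => if k = j then d j else 0 := by
    funext k
    by_cases hk : k = j
    · simp [hk]
    · simp [hk, Ne.symm hk]
  rw [h3] at h1
  exact h2.unique h1

/-- The blocks of an operator are determined by its transfer function. -/
theorem block_eq_of_hasSum {m p : ℕ} {A : Op 𝕜 m p} {Φ : ℂ → Matrix (Fin p) (Fin m) ℂ}
    (hA : HasTransferFunction A Φ) {a : ℤ → Matrix (Fin p) (Fin m) 𝕜}
    (ha : ∀ z : ℂ, ‖z‖ = 1 → HasSum (fun k : ℤ => z ^ (-k) • toC (a k)) (Φ z)) (i j : ℤ) :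
    block A i j = a (i - j) := by
  have key : ∀ k, block A k 0 = a k := by
    intro k
    apply toC_injective
    ext x y
    have : (fun k => toC (block A k 0) x y - toC (a k) x y) = 0 := by
      apply eq_zero_of_hasSum_zpow
      intro z hz
      have h1 := (hA.2 z hz).sub (ha z hz)
      rw [sub_self] at h1
      have h2 := Pi.hasSum.1 (Pi.hasSum.1 h1 x) y
      simpa [mul_sub] using h2
    exact sub_eq_zero.1 (congrFun this k)
  have shift : ∀ N : ℕ, ∀ i j : ℤ, block A (i + N) (j + N) = block A i j := by
    intro N
    induction N with
    | zero => simp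
    | succ N ih =>
      intro i j
      rw [← ih i j, ← hA.1 (i + N) (j + N)]
      push_cast; simp only [add_assoc]
  rw [← key]
  -- Unit shifts go forward only, so a nonnegative column is reached from column 0 and a negative
  -- one is pushed up to it.
  rcases le_total 0 j with hj | hj
  · have := shift j.toNat (i - j) 0
    rw [← this, Int.toNat_of_nonneg hj]; simp
  · have := shift (-j).toNat i j
    rw [← this, Int.toNat_of_nonneg (by lia)]; simp [sub_eq_add_neg]

/-! ### Block Toeplitz operators with absolutely summable blocks. -/

section toeplitz

variable {m p : ℕ}

/-- A matrix acting between Euclidean spaces. -/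
def matCLM (M : Matrix (Fin p) (Fin m) 𝕜) : EuclideanSpace 𝕜 (Fin m) →L[𝕜] EuclideanSpace 𝕜 (Fin p) :=
  LinearMap.toContinuousLinearMap (Matrix.toEuclideanLin M)

theorem matCLM_apply (M : Matrix (Fin p) (Fin m) 𝕜) (x : EuclideanSpace 𝕜 (Fin m)) (i : Fin p) :
    matCLM M x i = (M *ᵥ x.ofLp) i := rfl

theorem norm_matCLM_le (M : Matrix (Fin p) (Fin m) 𝕜) : ‖matCLM M‖ ≤ ∑ i, ∑ j, ‖M i j‖ := by
  refine ContinuousLinearMap.opNorm_le_bound _ (by positivity) fun x => ?_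
  have h : matCLM M x = ∑ i, EuclideanSpace.single i ((M *ᵥ x.ofLp) i) := by
    ext i
    simp [matCLM_apply, Pi.single_apply]
  rw [h, Finset.sum_mul]
  refine (norm_sum_le _ _).trans (Finset.sum_le_sum fun i _ => ?_)
  rw [PiLp.norm_single, Finset.sum_mul]
  refine (norm_sum_le Finset.univ fun j => M i j * x j).trans (Finset.sum_le_sum fun j _ => ?_)
  rw [norm_mul]
  exact mul_le_mul_of_nonneg_left (PiLp.norm_apply_le x j) (norm_nonneg _)

theorem summable_norm_matCLM {ι : Type*} {a : ι → Matrix (Fin p) (Fin m) 𝕜} (h : Summable a) :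
    Summable fun k => ‖matCLM (a k)‖ := by
  rw [summable_matrix_iff] at h
  exact Summable.of_nonneg_of_le (fun _ => norm_nonneg _) (fun k => norm_matCLM_le (a k))
    (summable_sum fun i _ => summable_sum fun j _ => h i j)

theorem signal_summable_sq (u : Signal 𝕜 m) : Summable fun i => ‖u i‖ ^ 2 := by
  simpa using (lp.memℓp u).summable (by simp)

theorem signal_norm_sq (u : Signal 𝕜 m) : ‖u‖ ^ 2 = ∑' i, ‖u i‖ ^ 2 := by
  simpa using lp.norm_rpow_eq_tsum (p := 2) (by simp) u

theorem signal_norm_le {u : Signal 𝕜 m} {C : ℝ} (hC : 0 ≤ C)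
    (h : ∀ s : Finset ℤ, ∑ i ∈ s, ‖u i‖ ^ 2 ≤ C ^ 2) : ‖u‖ ≤ C := by
  refine lp.norm_le_of_forall_sum_le (by simp) hC fun s => ?_
  simpa using h s

/-- The operator with the single nonzero block diagonal `k`, on which the blocks equal `M`. -/
def diagonalOp (k : ℤ) (M : EuclideanSpace 𝕜 (Fin m) →L[𝕜] EuclideanSpace 𝕜 (Fin p)) : Op 𝕜 m p :=
  LinearMap.mkContinuous
    { toFun := fun u => ⟨fun i => M (u (i - k)), by
        refine memℓp_gen ?_
        have h := ((Equiv.subRight k).summable_iff.2 (signal_summable_sq u)).mul_left (‖M‖ ^ 2)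
        refine Summable.of_nonneg_of_le (fun _ => by positivity) (fun i => ?_) h
        simpa [← mul_pow] using pow_le_pow_left₀ (norm_nonneg _) (M.le_opNorm (u (i - k))) 2⟩
      map_add' := fun u v => by
        ext i : 2
        exact map_add M (u (i - k)) (v (i - k))
      map_smul' := fun c u => by
        ext i : 2
        exact map_smul M c (u (i - k)) }
    ‖M‖ (fun u => by
      refine signal_norm_le (by positivity) fun s => ?_
      calc ∑ i ∈ s, ‖M (u (i - k))‖ ^ 2 ≤ ∑ i ∈ s, ‖M‖ ^ 2 * ‖u (i - k)‖ ^ 2 := by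
            refine Finset.sum_le_sum fun i _ => ?_
            rw [← mul_pow]
            exact pow_le_pow_left₀ (norm_nonneg _) (M.le_opNorm _) 2
        _ = ‖M‖ ^ 2 * ∑ i ∈ s.map (Equiv.subRight k).toEmbedding, ‖u i‖ ^ 2 := by
            rw [← Finset.mul_sum, Finset.sum_map]; rfl
        _ ≤ (‖M‖ * ‖u‖) ^ 2 := by
            rw [mul_pow, signal_norm_sq u]
            exact mul_le_mul_of_nonneg_left
              ((signal_summable_sq u).sum_le_tsum _ fun _ _ => by positivity) (by positivity))

theorem diagonalOp_apply (k : ℤ) (M : EuclideanSpace 𝕜 (Fin m) →L[𝕜] EuclideanSpace 𝕜 (Fin p))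
    (u : Signal 𝕜 m) (i : ℤ) : diagonalOp k M u i = M (u (i - k)) := rfl

theorem norm_diagonalOp_le (k : ℤ)
    (M : EuclideanSpace 𝕜 (Fin m) →L[𝕜] EuclideanSpace 𝕜 (Fin p)) : ‖diagonalOp k M‖ ≤ ‖M‖ :=
  LinearMap.mkContinuous_norm_le _ (norm_nonneg _) _

/-- The block Toeplitz operator with absolutely summable blocks `a k`. -/
def toeplitzOp (a : ℤ → Matrix (Fin p) (Fin m) 𝕜) : Op 𝕜 m p :=
  ∑' k, diagonalOp k (matCLM (a k))

/-- The defining series converges in operator norm, so entries can be read term by term, and only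
the diagonal k = i - j contributes. -/
theorem block_toeplitzOp {a : ℤ → Matrix (Fin p) (Fin m) 𝕜} (ha : Summable a) (i j : ℤ) :
    block (toeplitzOp a) i j = a (i - j) := by
  have hs : Summable fun k => diagonalOp k (matCLM (a k)) :=
    Summable.of_norm_bounded (summable_norm_matCLM ha) fun k => norm_diagonalOp_le _ _
  ext x y
  have h1 := hs.hasSum.mapL (ContinuousLinearMap.apply 𝕜 (Signal 𝕜 p)
    (lp.single 2 j (EuclideanSpace.single y (1 : 𝕜)) : Signal 𝕜 m))
  have h2 := h1.mapL (lp.evalCLM 𝕜 (fun _ : ℤ => EuclideanSpace 𝕜 (Fin p)) (p := 2) i)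
  have h3 := h2.mapL (EuclideanSpace.proj x : EuclideanSpace 𝕜 (Fin p) →L[𝕜] 𝕜)
  refine h3.unique ?_
  convert hasSum_ite_eq (i - j) (a (i - j) x y) using 2 with k
  change (diagonalOp k (matCLM (a k)) (lp.single 2 j (EuclideanSpace.single y (1 : 𝕜)))) i x = _
  rw [diagonalOp_apply, matCLM_apply, lp.single_apply]
  by_cases hk : k = i - j
  · subst hk
    simp
  · rw [if_neg hk, Pi.single_eq_of_ne (by lia)]
    simp

theorem hasTransferFunction_toeplitzOp {a : ℤ → Matrix (Fin p) (Fin m) 𝕜} (ha : Summable a)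
    {Φ : ℂ → Matrix (Fin p) (Fin m) ℂ}
    (h : ∀ z : ℂ, ‖z‖ = 1 → HasSum (fun k : ℤ => z ^ (-k) • toC (a k)) (Φ z)) :
    HasTransferFunction (toeplitzOp a) Φ := by
  refine ⟨fun i j => ?_, fun z hz => ?_⟩
  · simp [block_toeplitzOp ha]
  · simpa [block_toeplitzOp ha] using h z hz

end toeplitz

/-! ### Real part of the Hermitian inner product. -/

section reDot

variable {n m : ℕ}

/-- The real part of the standard Hermitian inner product. -/
def reDot (x y : Fin n → 𝕜) : ℝ := RCLike.re (star x ⬝ᵥ y)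

theorem reDot_add_left (x y z : Fin n → 𝕜) : reDot (x + y) z = reDot x z + reDot y z := by
  simp [reDot, add_dotProduct]

theorem reDot_add_right (x y z : Fin n → 𝕜) : reDot x (y + z) = reDot x y + reDot x z := by
  simp [reDot, dotProduct_add]

theorem reDot_sub_left (x y z : Fin n → 𝕜) : reDot (x - y) z = reDot x z - reDot y z := by
  simp [reDot, sub_dotProduct]

theorem reDot_sub_right (x y z : Fin n → 𝕜) : reDot x (y - z) = reDot x y - reDot x z := by
  simp [reDot, dotProduct_sub]

theorem reDot_smul_right (c : ℝ) (x y : Fin n → 𝕜) : reDot x (c • y) = c * reDot x y := by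
  simp [reDot, dotProduct_smul, RCLike.smul_re]

theorem reDot_comm (x y : Fin n → 𝕜) : reDot x y = reDot y x := by
  rw [reDot, reDot, Matrix.star_dotProduct, ← RCLike.conj_re]
  simp

theorem reDot_mulVec (M : Matrix (Fin n) (Fin m) 𝕜) (x : Fin n → 𝕜) (y : Fin m → 𝕜) :
    reDot x (M *ᵥ y) = reDot (Mᴴ *ᵥ x) y := by
  rw [reDot, reDot, Matrix.star_mulVec, Matrix.conjTranspose_conjTranspose,
    Matrix.dotProduct_mulVec]

theorem reDot_self (x : Fin n → 𝕜) : reDot x x = ∑ i, ‖x i‖ ^ 2 := by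
  rw [reDot, dotProduct, map_sum]
  refine Finset.sum_congr rfl fun i _ => ?_
  rw [Pi.star_apply, RCLike.star_def, RCLike.conj_mul, ← RCLike.ofReal_pow, RCLike.ofReal_re]

theorem reDot_self_nonneg (x : Fin n → 𝕜) : 0 ≤ reDot x x := by
  rw [reDot_self]; positivity

theorem reDot_self_eq_zero {x : Fin n → 𝕜} : reDot x x = 0 ↔ x = 0 := by
  rw [reDot_self, Finset.sum_eq_zero_iff_of_nonneg (fun _ _ => by positivity)]
  simp [funext_iff]

theorem reDot_self_ofLp (x : EuclideanSpace 𝕜 (Fin n)) : reDot x.ofLp x.ofLp = ‖x‖ ^ 2 := by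
  rw [reDot_self, EuclideanSpace.norm_sq_eq]

theorem posSemidef_reDot_nonneg {M : Matrix (Fin n) (Fin n) 𝕜} (h : M.PosSemidef)
    (x : Fin n → 𝕜) : 0 ≤ reDot x (M *ᵥ x) :=
  (RCLike.nonneg_iff.1 (h.dotProduct_mulVec_nonneg x)).1

theorem isHermitian_im_eq_zero {M : Matrix (Fin n) (Fin n) 𝕜} (h : M.IsHermitian)
    (x : Fin n → 𝕜) : RCLike.im (star x ⬝ᵥ (M *ᵥ x)) = 0 := by
  rw [← RCLike.conj_eq_iff_im]
  change star _ = _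
  rw [← Matrix.star_dotProduct, Matrix.star_mulVec, h.eq, Matrix.dotProduct_mulVec]

theorem posSemidef_of_reDot {M : Matrix (Fin n) (Fin n) 𝕜} (h : M.IsHermitian)
    (h0 : ∀ x, 0 ≤ reDot x (M *ᵥ x)) : M.PosSemidef :=
  .of_dotProduct_mulVec_nonneg h fun x =>
    RCLike.nonneg_iff.2 ⟨h0 x, isHermitian_im_eq_zero h x⟩

theorem posDef_of_reDot {M : Matrix (Fin n) (Fin n) 𝕜} (h : M.IsHermitian)
    (h0 : ∀ x, x ≠ 0 → 0 < reDot x (M *ᵥ x)) : M.PosDef :=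
  .of_dotProduct_mulVec_pos h fun x hx =>
    RCLike.pos_iff.2 ⟨h0 x hx, isHermitian_im_eq_zero h x⟩

theorem reDot_pos {M : Matrix (Fin n) (Fin n) 𝕜} (h : M.PosDef) {x : Fin n → 𝕜} (hx : x ≠ 0) :
    0 < reDot x (M *ᵥ x) :=
  (RCLike.pos_iff.1 (h.dotProduct_mulVec_pos hx)).1

theorem continuous_reDot : Continuous fun q : (Fin n → 𝕜) × (Fin n → 𝕜) => reDot q.1 q.2 :=
  RCLike.continuous_re.comp (Continuous.dotProduct (continuous_star.comp continuous_fst)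
    continuous_snd)

end reDot

/-! ### Discrete Lyapunov equations and Gramians. -/

section lyapunov

variable {n p m : ℕ} {F : Matrix (Fin n) (Fin n) 𝕜}

theorem tendsto_pow_zero (hF : Summable fun k : ℕ => F ^ k) :
    Filter.Tendsto (fun k : ℕ => F ^ k) Filter.atTop (nhds 0) := hF.tendsto_atTop_zero

theorem summable_pow_conjTranspose (hF : Summable fun k : ℕ => F ^ k) :
    Summable fun k : ℕ => Fᴴ ^ k := by
  simpa only [Matrix.conjTranspose_pow] using hF.matrix_conjTranspose

/-- Iterating a discrete Lyapunov equation. -/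
theorem lyapunov_iterate {Z Q : Matrix (Fin n) (Fin n) 𝕜} (hZ : Z = Fᴴ * Z * F + Q) (N : ℕ) :
    Z = ∑ k ∈ Finset.range N, Fᴴ ^ k * Q * F ^ k + Fᴴ ^ N * Z * F ^ N := by
  induction N with
  | zero => simp
  | succ N ih =>
    rw [Finset.sum_range_succ, add_assoc]
    have : Fᴴ ^ N * Z * F ^ N = Fᴴ ^ N * Q * F ^ N + Fᴴ ^ (N + 1) * Z * F ^ (N + 1) := by
      conv_lhs => rw [hZ]
      rw [pow_succ, pow_succ']
      noncomm_ring
    rw [← this, ← ih]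

theorem tendsto_conj_pow (hF : Summable fun k : ℕ => F ^ k) (Z : Matrix (Fin n) (Fin n) 𝕜) :
    Filter.Tendsto (fun N : ℕ => Fᴴ ^ N * Z * F ^ N) Filter.atTop (nhds 0) := by
  have h := ((tendsto_pow_zero (summable_pow_conjTranspose hF)).mul_const Z).mul
    (tendsto_pow_zero hF)
  simpa using h

theorem tendsto_lyapunov_sum (hF : Summable fun k : ℕ => F ^ k) {Z Q : Matrix (Fin n) (Fin n) 𝕜}
    (hZ : Z = Fᴴ * Z * F + Q) :
    Filter.Tendsto (fun N : ℕ => ∑ k ∈ Finset.range N, Fᴴ ^ k * Q * F ^ k) Filter.atTop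
      (nhds Z) := by
  have h := (tendsto_const_nhds (x := Z)).sub (tendsto_conj_pow hF Z)
  rw [sub_zero] at h
  refine h.congr fun N => ?_
  conv_lhs => enter [1]; rw [lyapunov_iterate hZ N]
  abel

theorem lyapunov_unique (hF : Summable fun k : ℕ => F ^ k) {Z Z' Q : Matrix (Fin n) (Fin n) 𝕜}
    (hZ : Z = Fᴴ * Z * F + Q) (hZ' : Z' = Fᴴ * Z' * F + Q) : Z = Z' :=
  tendsto_nhds_unique (tendsto_lyapunov_sum hF hZ) (tendsto_lyapunov_sum hF hZ')

/-- Uniqueness makes the linear map Z ↦ Z - F*ZF injective, hence surjective in finite dimension. -/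
theorem existsUnique_lyapunov (hF : Summable fun k : ℕ => F ^ k) (Q : Matrix (Fin n) (Fin n) 𝕜) :
    ∃! Z : Matrix (Fin n) (Fin n) 𝕜, Z = Fᴴ * Z * F + Q := by
  let φ : Matrix (Fin n) (Fin n) 𝕜 →ₗ[𝕜] Matrix (Fin n) (Fin n) 𝕜 :=
    LinearMap.id - LinearMap.mulLeft 𝕜 Fᴴ ∘ₗ LinearMap.mulRight 𝕜 F
  have hφ : ∀ Z, φ Z = Z - Fᴴ * Z * F := fun Z => by simp [φ, mul_assoc]
  have hinj : Function.Injective φ := by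
    rw [← LinearMap.ker_eq_bot, LinearMap.ker_eq_bot']
    intro Z hZ
    refine lyapunov_unique hF (Q := 0) ?_ (by simp)
    rw [hφ, sub_eq_zero] at hZ
    rw [add_zero, ← hZ]
  obtain ⟨Z, hZ⟩ := LinearMap.injective_iff_surjective.1 hinj Q
  have hZ' : Z = Fᴴ * Z * F + Q := by rw [← hZ, hφ]; abel
  exact ⟨Z, hZ', fun Y hY => lyapunov_unique hF hY hZ'⟩

variable {H : Matrix (Fin p) (Fin n) 𝕜} {Z : Matrix (Fin n) (Fin n) 𝕜}

theorem lyapunov_isHermitian (hF : Summable fun k : ℕ => F ^ k)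
    (hZ : Z = Fᴴ * Z * F + Hᴴ * H) : Z.IsHermitian := by
  refine lyapunov_unique hF (Q := Hᴴ * H) ?_ hZ
  conv_lhs => rw [hZ]
  simp [Matrix.conjTranspose_mul, mul_assoc]

theorem reDot_conjTranspose_mul_self (H : Matrix (Fin p) (Fin n) 𝕜) (x : Fin n → 𝕜) :
    reDot x ((Hᴴ * H) *ᵥ x) = reDot (H *ᵥ x) (H *ᵥ x) := by
  rw [← Matrix.mulVec_mulVec, reDot_mulVec, Matrix.conjTranspose_conjTranspose]

/-- Energy balance: the form of Z at x is the output energy of the first N free steps plus the form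
at the state reached. Letting N → ∞ makes Z the total output energy. -/
theorem reDot_lyapunov_iterate (hZ : Z = Fᴴ * Z * F + Hᴴ * H) (x : Fin n → 𝕜) (N : ℕ) :
    reDot x (Z *ᵥ x) = ∑ k ∈ Finset.range N, reDot ((H * F ^ k) *ᵥ x) ((H * F ^ k) *ᵥ x) +
      reDot (F ^ N *ᵥ x) (Z *ᵥ (F ^ N *ᵥ x)) := by
  induction N with
  | zero => simp
  | succ N ih =>
    rw [ih, Finset.sum_range_succ, add_assoc]
    congr 1
    nth_rewrite 1 [hZ]
    rw [Matrix.add_mulVec, reDot_add_right, reDot_conjTranspose_mul_self, add_comm]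
    congr 1
    · simp [Matrix.mulVec_mulVec]
    · rw [mul_assoc, ← Matrix.mulVec_mulVec, reDot_mulVec, Matrix.conjTranspose_conjTranspose,
        ← Matrix.mulVec_mulVec, Matrix.mulVec_mulVec, pow_succ']

theorem tendsto_reDot_pow (hF : Summable fun k : ℕ => F ^ k) (Z : Matrix (Fin n) (Fin n) 𝕜)
    (x : Fin n → 𝕜) : Filter.Tendsto (fun N : ℕ => reDot (F ^ N *ᵥ x) (Z *ᵥ (F ^ N *ᵥ x)))
      Filter.atTop (nhds 0) := by
  have h1 : Continuous fun A : Matrix (Fin n) (Fin n) 𝕜 => reDot (A *ᵥ x) (Z *ᵥ (A *ᵥ x)) := by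
    have : Continuous fun A : Matrix (Fin n) (Fin n) 𝕜 => A *ᵥ x :=
      continuous_id.matrix_mulVec continuous_const
    exact continuous_reDot.comp (this.prodMk (continuous_const.matrix_mulVec this))
  have h2 := (h1.tendsto 0).comp (tendsto_pow_zero hF)
  have h3 : reDot ((0 : Matrix (Fin n) (Fin n) 𝕜) *ᵥ x)
      (Z *ᵥ ((0 : Matrix (Fin n) (Fin n) 𝕜) *ᵥ x)) = 0 := by simp [reDot]
  rwa [h3] at h2

theorem lyapunov_posSemidef (hF : Summable fun k : ℕ => F ^ k)
    (hZ : Z = Fᴴ * Z * F + Hᴴ * H) : Z.PosSemidef := by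
  refine posSemidef_of_reDot (lyapunov_isHermitian hF hZ) fun x => ?_
  refine le_of_tendsto (tendsto_reDot_pow hF Z x) (Filter.Eventually.of_forall fun N => ?_)
  rw [reDot_lyapunov_iterate hZ x N]
  exact le_add_of_nonneg_left (Finset.sum_nonneg fun _ _ => reDot_self_nonneg _)

theorem IsObservable.eq_zero (h : IsObservable F H) {x : Fin n → 𝕜}
    (hx : ∀ k < n, (H * F ^ k) *ᵥ x = 0) : x = 0 := by
  set O : Matrix (Fin n × Fin p) (Fin n) 𝕜 :=
    Matrix.of fun (ki : Fin n × Fin p) (j : Fin n) => (H * F ^ (ki.1 : ℕ)) ki.2 j with hO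
  have h1 : O.rank = n := h
  have h2 := LinearMap.finrank_range_add_finrank_ker O.mulVecLin
  rw [← Matrix.rank, h1, Module.finrank_fin_fun] at h2
  have h3 : LinearMap.ker O.mulVecLin = ⊥ := Submodule.finrank_eq_zero.1 (by lia)
  refine (LinearMap.ker_eq_bot'.1 h3) x ?_
  ext ⟨k, i⟩
  exact congrFun (hx k k.2) i

/-- A vector of zero energy produces n zero outputs, which observability excludes unless the vector
is zero. -/
theorem lyapunov_posDef (hF : Summable fun k : ℕ => F ^ k) (hobs : IsObservable F H)
    (hZ : Z = Fᴴ * Z * F + Hᴴ * H) : Z.PosDef := by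
  refine posDef_of_reDot (lyapunov_isHermitian hF hZ) fun x hx => ?_
  by_contra hle
  refine hx (hobs.eq_zero fun k hk => ?_)
  have h1 := reDot_lyapunov_iterate hZ x n
  have h2 := posSemidef_reDot_nonneg (lyapunov_posSemidef hF hZ) (F ^ n *ᵥ x)
  have h3 : ∑ k ∈ Finset.range n, reDot ((H * F ^ k) *ᵥ x) ((H * F ^ k) *ᵥ x) = 0 :=
    le_antisymm (by linarith) (Finset.sum_nonneg fun _ _ => reDot_self_nonneg _)
  rw [Finset.sum_eq_zero_iff_of_nonneg fun _ _ => reDot_self_nonneg _] at h3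
  exact reDot_self_eq_zero.1 (h3 k (Finset.mem_range.2 hk))

theorem IsControllable.isObservable {G : Matrix (Fin n) (Fin m) 𝕜} (h : IsControllable F G) :
    IsObservable Fᴴ Gᴴ := by
  rw [IsControllable, ← Matrix.rank_conjTranspose] at h
  refine Eq.trans ?_ h
  congr 1
  ext ⟨k, i⟩ j
  simp only [Matrix.of_apply, Matrix.conjTranspose_apply]
  rw [← Matrix.conjTranspose_pow, ← Matrix.conjTranspose_mul, Matrix.conjTranspose_apply]

end lyapunov

/-! ### Algebra of the gain and of the closed-loop matrix. -/

section gain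

variable {n m p : ℕ} {F P Zg : Matrix (Fin n) (Fin n) 𝕜} {G : Matrix (Fin n) (Fin m) 𝕜}
  {H : Matrix (Fin p) (Fin n) 𝕜}

theorem mul_gainK (hu : IsUnit (1 - Fᴴ * Zg * F * P)) :
    (1 - Fᴴ * Zg * F * P) * gainK F G P Zg = Fᴴ * Zg * G := by
  have h := Matrix.mul_nonsing_inv _ ((Matrix.isUnit_iff_isUnit_det _).1 hu)
  rw [gainK, ← Matrix.mul_assoc, ← Matrix.mul_assoc, ← Matrix.mul_assoc, h, Matrix.one_mul]

/-- Substituting GG* = Π - FΠF* eliminates G; this inverse-free form drives both the stability proof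
and the dissipation inequality. -/
theorem mul_stateF (hu : IsUnit (1 - Fᴴ * Zg * F * P)) (hP : P = F * P * Fᴴ + G * Gᴴ) :
    (1 - Fᴴ * Zg * F * P) * stateF F G P Zg = Fᴴ * (1 - Zg * P) := by
  have h : G * Gᴴ = P - F * P * Fᴴ := by rw [eq_sub_iff_add_eq']; exact hP.symm
  rw [stateF, mul_sub, ← Matrix.mul_assoc, mul_gainK hu, Matrix.mul_assoc (Fᴴ * Zg) G, h]
  noncomm_ring

/-- Contractivity of `F` in the metric of the inverse of a Gramian. -/
theorem posSemidef_inv_sub {Q : Matrix (Fin n) (Fin n) 𝕜} (hQ : Q.PosSemidef) (hPQ : P * Q = 1)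
    (hP : P = F * P * Fᴴ + G * Gᴴ) (hPh : P.IsHermitian) : (Q - Fᴴ * Q * F).PosSemidef := by
  have h : G * Gᴴ = P - F * P * Fᴴ := by rw [eq_sub_iff_add_eq']; exact hP.symm
  have hQP : Q * P = 1 := mul_eq_one_comm.1 hPQ
  -- Completion of the square, with the remainder supplied by GG* = P - FPF*.
  have key : Q - Fᴴ * Q * F = (1 - P * Fᴴ * Q * F)ᴴ * Q * (1 - P * Fᴴ * Q * F) +
      (Gᴴ * Q * F)ᴴ * (Gᴴ * Q * F) := by
    have e1 : (Gᴴ * Q * F)ᴴ * (Gᴴ * Q * F) = Fᴴ * Q * (G * Gᴴ) * (Q * F) := by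
      simp only [Matrix.conjTranspose_mul, Matrix.conjTranspose_conjTranspose, hQ.isHermitian.eq,
        Matrix.mul_assoc]
    have e2 : (1 - P * Fᴴ * Q * F)ᴴ = 1 - Fᴴ * Q * F * P := by
      simp only [Matrix.conjTranspose_sub, Matrix.conjTranspose_one, Matrix.conjTranspose_mul,
        Matrix.conjTranspose_conjTranspose, hQ.isHermitian.eq, hPh.eq, Matrix.mul_assoc]
    have e3 : (1 - Fᴴ * Q * F * P) * Q * (1 - P * Fᴴ * Q * F) =
        Q - (Q * P) * Fᴴ * Q * F - Fᴴ * Q * F * (P * Q) +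
          Fᴴ * Q * F * (P * Q) * P * Fᴴ * Q * F := by noncomm_ring
    have e4 : Fᴴ * Q * (P - F * P * Fᴴ) * (Q * F) =
        Fᴴ * (Q * P) * Q * F - Fᴴ * Q * F * P * Fᴴ * Q * F := by noncomm_ring
    rw [e1, e2, e3, h, e4, hPQ, hQP]
    noncomm_ring
  rw [key]
  exact (hQ.conjTranspose_mul_mul_same _).add (Matrix.posSemidef_conjTranspose_mul_self _)

/-- The inequality Zg ≤ P⁻¹ in a form with no inverse, proved by a sum of two congruences instead of
square roots. It is the slack term in `dissipation`. -/
theorem posSemidef_sub_mul_mul {Q : Matrix (Fin n) (Fin n) 𝕜} (hPQ : P * Q = 1)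
    (hPh : P.IsHermitian) (hZ : Zg.PosSemidef) (hR : (Q - Zg).PosSemidef) :
    (Zg - Zg * P * Zg).PosSemidef := by
  have hQP : Q * P = 1 := mul_eq_one_comm.1 hPQ
  have key : Zg - Zg * P * Zg =
      (P * Zg)ᴴ * (Q - Zg) * (P * Zg) + (1 - P * Zg)ᴴ * Zg * (1 - P * Zg) := by
    simp only [Matrix.conjTranspose_sub, Matrix.conjTranspose_one, Matrix.conjTranspose_mul,
      hZ.isHermitian.eq, hPh.eq]
    have e : Zg * P * (Q - Zg) * (P * Zg) =
      Zg * P * (Q * P) * Zg - Zg * P * Zg * P * Zg := by noncomm_ring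
    rw [e, hQP]
    noncomm_ring
  rw [key]
  exact (hR.conjTranspose_mul_mul_same _).add (hZ.conjTranspose_mul_mul_same _)

end gain

/-! ### Stability of F_γ. -/

theorem reDot_smul_smul {n : ℕ} (a : 𝕜) (x y : Fin n → 𝕜) :
    reDot (a • x) (a • y) = ‖a‖ ^ 2 * reDot x y := by
  rw [reDot, reDot, star_smul, smul_dotProduct, dotProduct_smul, smul_smul, RCLike.star_def,
    RCLike.conj_mul, ← RCLike.ofReal_pow, smul_eq_mul, RCLike.re_ofReal_mul]

theorem exists_eigenvector {n : ℕ} {A : Matrix (Fin n) (Fin n) ℂ} {μ : ℂ}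
    (h : μ ∈ spectrum ℂ A) : ∃ x, x ≠ 0 ∧ A *ᵥ x = μ • x := by
  rw [spectrum.mem_iff, Matrix.isUnit_iff_isUnit_det, isUnit_iff_ne_zero, not_not] at h
  obtain ⟨x, hx, h0⟩ := Matrix.exists_mulVec_eq_zero_iff.2 h
  refine ⟨x, hx, ?_⟩
  rw [Matrix.sub_mulVec, sub_eq_zero, Algebra.algebraMap_eq_smul_one, Matrix.smul_mulVec,
    Matrix.one_mulVec] at h0
  exact h0.symm

theorem mem_spectrum_of_eigenvector {n : ℕ} {A : Matrix (Fin n) (Fin n) ℂ} {μ : ℂ}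
    {x : Fin n → ℂ} (hx : x ≠ 0) (h : A *ᵥ x = μ • x) : μ ∈ spectrum ℂ A := by
  rw [spectrum.mem_iff, Matrix.isUnit_iff_isUnit_det, isUnit_iff_ne_zero, not_not]
  refine Matrix.exists_mulVec_eq_zero_iff.1 ⟨x, hx, ?_⟩
  rw [Matrix.sub_mulVec, sub_eq_zero, Algebra.algebraMap_eq_smul_one, Matrix.smul_mulVec,
    Matrix.one_mulVec, h]

/-- Suppose F_γx = μx with |μ| ≥ 1, and put y = Px, R = Q - Zg, a = Re y*v. Nonnegativity of R at Fy
- μ̄y yields (1 - |μ|²)a ≥ |μ|²c|Hy|², so Hy = 0. Then v = Ry is an eigenvector of F* for μ,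
contradicting stability of F. R may be singular, as it is at the optimal level. -/
theorem norm_lt_one_of_mem_spectrum_state {n m p : ℕ} {F P Q Zg A : Matrix (Fin n) (Fin n) ℂ}
    {G : Matrix (Fin n) (Fin m) ℂ} {H : Matrix (Fin p) (Fin n) ℂ} {c : ℝ} (hc : 0 < c)
    (hF : ∀ μ ∈ spectrum ℂ F, ‖μ‖ < 1) (hQ : Q.PosSemidef) (hPQ : P * Q = 1)
    (hPh : P.IsHermitian) (hP : P = F * P * Fᴴ + G * Gᴴ)
    (hZ : Zg = Fᴴ * Zg * F + c • (Hᴴ * H)) (hR : (Q - Zg).PosSemidef)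
    (hu : IsUnit (1 - Fᴴ * Zg * F * P))
    (hA : (1 - Fᴴ * Zg * F * P) * A = Fᴴ * (1 - Zg * P)) :
    ∀ μ ∈ spectrum ℂ A, ‖μ‖ < 1 := by
  intro μ hμ
  by_contra hge
  rw [not_lt] at hge
  obtain ⟨x, hx, hAx⟩ := exists_eigenvector hμ
  have hQP : Q * P = 1 := mul_eq_one_comm.1 hPQ
  obtain ⟨y, hy⟩ : ∃ y, y = P *ᵥ x := ⟨_, rfl⟩
  obtain ⟨v, hv⟩ : ∃ v, v = (1 - Fᴴ * Zg * F * P) *ᵥ x := ⟨_, rfl⟩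
  have hv0 : v ≠ 0 := by
    intro h0
    apply hx
    have := Matrix.mulVec_injective_of_isUnit hu
    exact this (by rw [← hv, h0, Matrix.mulVec_zero])
  have hNy : v = (Q - Fᴴ * Zg * F) *ᵥ y := by
    rw [hv, hy, Matrix.mulVec_mulVec, sub_mul, hQP]
  have hRy : μ • v = Fᴴ *ᵥ ((Q - Zg) *ᵥ y) := by
    rw [hv, ← Matrix.mulVec_smul, ← hAx, Matrix.mulVec_mulVec, hA, hy, Matrix.mulVec_mulVec,
      Matrix.mulVec_mulVec, mul_assoc, sub_mul, hQP]
  have hN1 : v = (Q - Zg) *ᵥ y + c • ((Hᴴ * H) *ᵥ y) := by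
    rw [hNy, ← Matrix.smul_mulVec, ← Matrix.add_mulVec]
    congr 1
    rw [sub_add, sub_right_inj, eq_sub_iff_add_eq]
    exact hZ.symm
  have hN2 : v = (Q - Fᴴ * Q * F) *ᵥ y + Fᴴ *ᵥ ((Q - Zg) *ᵥ (F *ᵥ y)) := by
    rw [hNy, Matrix.mulVec_mulVec, Matrix.mulVec_mulVec, ← Matrix.add_mulVec]
    congr 1
    noncomm_ring
  set a := reDot y v with ha
  have a1 : a = reDot y ((Q - Zg) *ᵥ y) + c * reDot (H *ᵥ y) (H *ᵥ y) := by
    rw [ha, hN1, reDot_add_right, reDot_smul_right, reDot_conjTranspose_mul_self]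
  have a2 : reDot (F *ᵥ y) ((Q - Zg) *ᵥ (F *ᵥ y)) ≤ a := by
    rw [ha, hN2, reDot_add_right, reDot_mulVec Fᴴ, Matrix.conjTranspose_conjTranspose]
    have := posSemidef_reDot_nonneg (posSemidef_inv_sub hQ hPQ hP hPh) y
    linarith
  have a3 := posSemidef_reDot_nonneg hR (F *ᵥ y - star μ • y)
  have hcross : reDot (F *ᵥ y) ((Q - Zg) *ᵥ (star μ • y)) = ‖μ‖ ^ 2 * a := by
    have h1 := reDot_mulVec Fᴴ y ((Q - Zg) *ᵥ (star μ • y))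
    rw [Matrix.conjTranspose_conjTranspose] at h1
    rw [← h1, Matrix.mulVec_smul, Matrix.mulVec_smul, ← hRy, smul_smul, ha, ← reDot_smul_right,
      Complex.star_def, Complex.conj_mul', ← Complex.ofReal_pow, Complex.coe_smul]
  have hsq : reDot (star μ • y) ((Q - Zg) *ᵥ (star μ • y)) =
      ‖μ‖ ^ 2 * reDot y ((Q - Zg) *ᵥ y) := by
    rw [Matrix.mulVec_smul, reDot_smul_smul, norm_star]
  have hHy : H *ᵥ y = 0 := by
    rw [← reDot_self_eq_zero]
    have hsymm : reDot (star μ • y) ((Q - Zg) *ᵥ (F *ᵥ y)) = ‖μ‖ ^ 2 * a := by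
      rw [reDot_mulVec, hR.isHermitian.eq, reDot_comm, hcross]
    rw [Matrix.mulVec_sub, reDot_sub_left, reDot_sub_right, reDot_sub_right, hcross, hsq,
      hsymm] at a3
    have h0 := reDot_self_nonneg (H *ᵥ y)
    have h1 := posSemidef_reDot_nonneg hR y
    have h2 : 1 ≤ ‖μ‖ ^ 2 := one_le_pow₀ hge
    have h3 : 0 ≤ a := by rw [a1]; positivity
    have h4 : ‖μ‖ ^ 2 * (c * reDot (H *ᵥ y) (H *ᵥ y)) ≤ 0 := by nlinarith
    have h5 : c * reDot (H *ᵥ y) (H *ᵥ y) ≤ 0 := by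
      by_contra hpos
      rw [not_le] at hpos
      nlinarith
    exact le_antisymm (by by_contra hpos; rw [not_le] at hpos; nlinarith) h0
  have hvR : v = (Q - Zg) *ᵥ y := by
    rw [hN1, ← Matrix.mulVec_mulVec, hHy]; simp
  have hspec : μ ∈ spectrum ℂ (Fᴴ) := mem_spectrum_of_eigenvector hv0 (by rw [hRy, ← hvR])
  have : star μ ∈ spectrum ℂ F := by
    have h1 := (spectrum.star_mem_resolventSet_iff (R := ℂ) (r := μ) (a := F)).not
    exact h1.2 hspec
  have := hF _ this
  rw [norm_star] at this
  linarith

section complexification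

variable {n : ℕ}

open scoped MatrixOrder in
theorem exists_eq_conjTranspose_mul_self {A : Matrix (Fin n) (Fin n) 𝕜} (h : A.PosSemidef) :
    ∃ B : Matrix (Fin n) (Fin n) 𝕜, A = Bᴴ * B :=
  CStarAlgebra.nonneg_iff_eq_star_mul_self.1 h.nonneg

/-- For real matrices positivity is only known on real vectors; a factorization B*B carries it over
to complex ones. -/
theorem posSemidef_toC {A : Matrix (Fin n) (Fin n) 𝕜} (h : A.PosSemidef) :
    (toC A).PosSemidef := by
  obtain ⟨B, rfl⟩ := exists_eq_conjTranspose_mul_self h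
  rw [toC_mul, toC_conjTranspose]
  exact Matrix.posSemidef_conjTranspose_mul_self _

/-- The state matrix of the central solution is stable. -/
theorem isStable_stateF {m p : ℕ} {F P Zg : Matrix (Fin n) (Fin n) 𝕜}
    {G : Matrix (Fin n) (Fin m) 𝕜} {H : Matrix (Fin p) (Fin n) 𝕜} {c : ℝ} (hc : 0 < c)
    (hF : IsStable F) (hPd : P.PosDef) (hP : P = F * P * Fᴴ + G * Gᴴ)
    (hZ : Zg = Fᴴ * Zg * F + c • (Hᴴ * H)) (hR : (P⁻¹ - Zg).PosSemidef)
    (hu : IsUnit (1 - Fᴴ * Zg * F * P)) : IsStable (stateF F G P Zg) := by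
  have hPQ : P * P⁻¹ = 1 :=
    Matrix.mul_nonsing_inv _ ((Matrix.isUnit_iff_isUnit_det _).1 hPd.isUnit)
  refine norm_lt_one_of_mem_spectrum_state (F := toC F) (P := toC P) (Q := toC P⁻¹)
    (Zg := toC Zg) (G := toC G) (H := toC H) hc hF (posSemidef_toC hPd.inv.posSemidef) ?_
    (posSemidef_toC hPd.posSemidef).isHermitian ?_ ?_ ?_ ?_ ?_
  · rw [← toC_mul, hPQ, toC_one]
  · rw [← toC_conjTranspose, ← toC_conjTranspose, ← toC_mul, ← toC_mul, ← toC_mul, ← toC_add, ← hP]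
  · rw [← toC_conjTranspose, ← toC_conjTranspose, ← toC_mul, ← toC_mul, ← toC_mul, ← toC_smul,
      ← toC_add, ← hZ]
  · rw [← toC_sub]; exact posSemidef_toC hR
  · simpa only [toC_sub, toC_mul, toC_conjTranspose, toC_one] using isUnit_toC hu
  · simpa only [toC_sub, toC_mul, toC_conjTranspose, toC_one] using
      congrArg toC (mul_stateF hu hP)

end complexification

/-! ### The largest eigenvalue of ZΠ. -/

section spectral

variable {n : ℕ} {P Z : Matrix (Fin n) (Fin n) 𝕜}

/-- Going through the characteristic polynomial transfers real eigenvalues from a Hermitian M to a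
non-Hermitian A. -/
theorem mem_spectrum_toC_iff {A M : Matrix (Fin n) (Fin n) 𝕜} (hM : M.IsHermitian)
    (h : A.charpoly = M.charpoly) (μ : ℂ) :
    μ ∈ spectrum ℂ (toC A) ↔ ∃ i, μ = (hM.eigenvalues i : ℂ) := by
  rw [Matrix.mem_spectrum_iff_isRoot_charpoly, toC_eq_map, Matrix.charpoly_map, h, hM.charpoly_eq,
    Polynomial.IsRoot, Polynomial.map_prod, Polynomial.eval_prod, Finset.prod_eq_zero_iff]
  simp [sub_eq_zero, complexHom_ofReal]

theorem posSemidef_smul_one_sub {M : Matrix (Fin n) (Fin n) 𝕜} (hM : M.IsHermitian) {c : ℝ}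
    (hc : ∀ i, hM.eigenvalues i ≤ c) : (c • (1 : Matrix (Fin n) (Fin n) 𝕜) - M).PosSemidef := by
  set φ := Unitary.conjStarAlgAut 𝕜 (Matrix (Fin n) (Fin n) 𝕜) hM.eigenvectorUnitary
  have h1 : c • (1 : Matrix (Fin n) (Fin n) 𝕜) - M =
      φ (Matrix.diagonal fun i => ((c - hM.eigenvalues i : ℝ) : 𝕜)) := by
    have hd : (Matrix.diagonal fun i => ((c - hM.eigenvalues i : ℝ) : 𝕜)) =
        (c : 𝕜) • (1 : Matrix (Fin n) (Fin n) 𝕜) -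
          Matrix.diagonal (RCLike.ofReal ∘ hM.eigenvalues) := by
      ext i j
      by_cases hij : i = j
      · subst hij; simpa using Algebra.algebraMap_eq_smul_one c
      · simp [hij]
    rw [hd, map_sub, map_smul, map_one, ← hM.spectral_theorem, RCLike.real_smul_eq_coe_smul (K := 𝕜)]
  rw [h1, Unitary.conjStarAlgAut_apply]
  refine Matrix.PosSemidef.mul_mul_conjTranspose_same (Matrix.PosSemidef.diagonal fun i => ?_) _
  simpa using hc i

/-- The largest eigenvalue of the product of two positive definite matrices. -/
theorem exists_isMaxEigenvalue (hn : 0 < n) (hZ : Z.PosDef) (hP : P.PosDef) :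
    ∃ γ : ℝ, 0 < γ ∧ IsMaxEigenvalue (Z * P) (γ ^ 2) ∧
      (∃ w, w ≠ 0 ∧ (Z * P) *ᵥ w = (γ ^ 2) • w) ∧ (P⁻¹ - (γ ^ 2)⁻¹ • Z).PosSemidef := by
  obtain ⟨B, hB⟩ := exists_eq_conjTranspose_mul_self hP.posSemidef
  have hBu : IsUnit B := by
    have := hP.isUnit
    rw [hB, Matrix.isUnit_iff_isUnit_det, Matrix.det_mul] at this
    exact (Matrix.isUnit_iff_isUnit_det _).2 (isUnit_of_mul_isUnit_right this)
  have hBd := (Matrix.isUnit_iff_isUnit_det _).1 hBu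
  have hM : (B * Z * Bᴴ).PosDef :=
    (Matrix.IsUnit.posDef_star_right_conjugate_iff hBu).2 hZ
  have hMh := hM.isHermitian
  -- With P = B*B, cyclicity of the characteristic polynomial replaces ZB*B by the positive definite
  -- BZB*.
  have hchar : (Z * P).charpoly = (B * Z * Bᴴ).charpoly := by
    rw [hB, ← mul_assoc, Matrix.charpoly_mul_comm, mul_assoc]
  have : Nonempty (Fin n) := ⟨⟨0, hn⟩⟩
  obtain ⟨i, hi⟩ := Finite.exists_max hMh.eigenvalues
  have hpos : 0 < hMh.eigenvalues i := hM.eigenvalues_pos i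
  refine ⟨√(hMh.eigenvalues i), Real.sqrt_pos.2 hpos, ?_⟩
  rw [Real.sq_sqrt hpos.le]
  refine ⟨⟨fun μ hμ => ?_, ?_, fun x hx => ?_⟩, ?_, ?_⟩
  · obtain ⟨j, rfl⟩ := (mem_spectrum_toC_iff hMh hchar μ).1 hμ
    simp
  · exact (mem_spectrum_toC_iff hMh hchar _).2 ⟨i, rfl⟩
  · obtain ⟨j, hj⟩ := (mem_spectrum_toC_iff hMh hchar _).1 hx
    rw [Complex.ofReal_inj.1 hj]
    exact hi j
  · set v : Fin n → 𝕜 := (hMh.eigenvectorBasis i).ofLp with hv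
    have hMv : (B * Z * Bᴴ) *ᵥ v = hMh.eigenvalues i • v := hMh.mulVec_eigenvectorBasis i
    have hv0 : v ≠ 0 := by
      intro h0
      have h1 := hMh.eigenvectorBasis.orthonormal.ne_zero i
      exact h1 (by ext j; exact congrFun h0 j)
    have hBw : B *ᵥ ((Z * Bᴴ) *ᵥ v) = hMh.eigenvalues i • v := by
      rw [Matrix.mulVec_mulVec, ← mul_assoc, hMv]
    refine ⟨(Z * Bᴴ) *ᵥ v, fun h0 => ?_, ?_⟩
    · rw [h0, Matrix.mulVec_zero] at hBw
      exact (smul_ne_zero hpos.ne' hv0) hBw.symm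
    · rw [hB, ← mul_assoc, ← Matrix.mulVec_mulVec, hBw, Matrix.mulVec_smul]
  -- Congruence of λ - BZB* ≥ 0 by B⁻¹, divided by λ.
  · have h1 := (posSemidef_smul_one_sub hMh hi).mul_mul_conjTranspose_same B⁻¹
    have h2 := h1.smul (inv_nonneg.2 hpos.le)
    convert h2 using 1
    rw [hB, Matrix.mul_inv_rev, mul_sub, sub_mul, Matrix.conjTranspose_nonsing_inv, smul_sub]
    congr 1
    · rw [mul_smul_comm, smul_mul_assoc, smul_smul, inv_mul_cancel₀ hpos.ne', one_smul, mul_one]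
    · congr 1
      have e1 : B⁻¹ * B = 1 := Matrix.nonsing_inv_mul _ hBd
      have e2 : Bᴴ * Bᴴ⁻¹ = 1 := by
        rw [← Matrix.conjTranspose_nonsing_inv, ← Matrix.conjTranspose_mul, e1,
          Matrix.conjTranspose_one]
      calc Z = (B⁻¹ * B) * Z * (Bᴴ * Bᴴ⁻¹) := by rw [e1, e2]; simp
        _ = _ := by simp only [mul_assoc]

end spectral

/-! ### Storage function and dissipation inequality. -/

section energy

variable {n m p : ℕ} {F P Zg : Matrix (Fin n) (Fin n) 𝕜} {G : Matrix (Fin n) (Fin m) 𝕜}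
  {H : Matrix (Fin p) (Fin n) 𝕜} {c : ℝ}

/-- The quadratic storage function of the error system. -/
def storage (P Zg : Matrix (Fin n) (Fin n) 𝕜) (ξ η : Fin n → 𝕜) : ℝ :=
  reDot (P *ᵥ η - ξ) (Zg *ᵥ (P *ᵥ η - ξ)) + 2 * reDot ξ η - reDot η (P *ᵥ η)

theorem continuous_storage (P Zg : Matrix (Fin n) (Fin n) 𝕜) :
    Continuous fun q : (Fin n → 𝕜) × (Fin n → 𝕜) => storage P Zg q.1 q.2 := by
  have hP : Continuous fun q : (Fin n → 𝕜) × (Fin n → 𝕜) => P *ᵥ q.2 :=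
    continuous_const.matrix_mulVec continuous_snd
  have hd := hP.sub continuous_fst
  exact ((continuous_reDot.comp (hd.prodMk (continuous_const.matrix_mulVec hd))).add
    (continuous_const.mul continuous_reDot)).sub (continuous_reDot.comp (continuous_snd.prodMk hP))

theorem storage_zero (P Zg : Matrix (Fin n) (Fin n) 𝕜) : storage P Zg 0 0 = 0 := by
  simp [storage, reDot]

/-- The recursion for η made implicit: with the inverse cleared, η lies in the range of F*, at the
vector called s in `dissipation`. -/
theorem state_eq_of_step (hu : IsUnit (1 - Fᴴ * Zg * F * P)) (hP : P = F * P * Fᴴ + G * Gᴴ)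
    {h η : Fin n → 𝕜} {u : Fin m → 𝕜} (hη : η = stateF F G P Zg *ᵥ h + gainK F G P Zg *ᵥ u) :
    η = Fᴴ *ᵥ (h + Zg *ᵥ (F *ᵥ (P *ᵥ η) + G *ᵥ u - P *ᵥ h)) := by
  have h1 := congrArg ((1 - Fᴴ * Zg * F * P) *ᵥ ·) hη
  simp only [Matrix.mulVec_add, Matrix.mulVec_mulVec, mul_stateF hu hP, mul_gainK hu,
    Matrix.sub_mulVec, Matrix.one_mulVec, sub_eq_iff_eq_add] at h1
  refine h1.trans ?_
  simp only [Matrix.mulVec_add, Matrix.mulVec_sub, Matrix.mulVec_mulVec, mul_sub, Matrix.sub_mulVec,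
    ← Matrix.mul_assoc, mul_one]
  abel

/-- The dissipation inequality of the error system. -/
theorem dissipation (hc : 0 < c) (hu : IsUnit (1 - Fᴴ * Zg * F * P)) (hPd : P.PosDef)
    (hP : P = F * P * Fᴴ + G * Gᴴ) (hZ : Zg = Fᴴ * Zg * F + c⁻¹ • (Hᴴ * H))
    (hZs : Zg.PosSemidef) (hR : (P⁻¹ - Zg).PosSemidef) {h η ξ₀ ξ : Fin n → 𝕜} {u : Fin m → 𝕜}
    (hη : η = stateF F G P Zg *ᵥ h + gainK F G P Zg *ᵥ u) (hξ : ξ₀ = F *ᵥ ξ + G *ᵥ u) :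
    reDot (H *ᵥ (P *ᵥ η - ξ)) (H *ᵥ (P *ᵥ η - ξ)) ≤
      c * (reDot u u + storage P Zg ξ η - storage P Zg ξ₀ h) := by
  obtain ⟨w, hw⟩ : ∃ w, w = F *ᵥ (P *ᵥ η) + G *ᵥ u - P *ᵥ h := ⟨_, rfl⟩
  obtain ⟨q, hq⟩ : ∃ q, q = Zg *ᵥ w := ⟨_, rfl⟩
  obtain ⟨s, hs⟩ : ∃ s, s = h + q := ⟨_, rfl⟩
  have hηs : η = Fᴴ *ᵥ s := by
    rw [hs, hq, hw]; exact state_eq_of_step hu hP hη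
  have hPQ : P * P⁻¹ = 1 :=
    Matrix.mul_nonsing_inv _ ((Matrix.isUnit_iff_isUnit_det _).1 hPd.isUnit)
  obtain ⟨δ, hδ⟩ : ∃ δ, δ = P *ᵥ η - ξ := ⟨_, rfl⟩
  obtain ⟨δ₀, hδ₀⟩ : ∃ δ₀, δ₀ = P *ᵥ h - ξ₀ := ⟨_, rfl⟩
  have hFδ : F *ᵥ δ = δ₀ + w := by
    rw [hδ, hδ₀, hw, hξ, Matrix.mulVec_sub]; abel
  have hherm : ∀ x y, reDot x (Zg *ᵥ y) = reDot y (Zg *ᵥ x) := fun x y => by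
    rw [reDot_mulVec, hZs.isHermitian.eq, reDot_comm]
  have hPherm : ∀ x y, reDot x (P *ᵥ y) = reDot y (P *ᵥ x) := fun x y => by
    rw [reDot_mulVec, hPd.isHermitian.eq, reDot_comm]
  have e1 : reDot δ (Zg *ᵥ δ) = reDot (F *ᵥ δ) (Zg *ᵥ (F *ᵥ δ)) +
      c⁻¹ * reDot (H *ᵥ δ) (H *ᵥ δ) := by
    conv_lhs => rw [hZ]
    rw [Matrix.add_mulVec, reDot_add_right, Matrix.smul_mulVec, reDot_smul_right,
      reDot_conjTranspose_mul_self, ← Matrix.mulVec_mulVec, ← Matrix.mulVec_mulVec,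
      reDot_mulVec Fᴴ, Matrix.conjTranspose_conjTranspose]
  have e2 : reDot (F *ᵥ δ) (Zg *ᵥ (F *ᵥ δ)) =
      reDot δ₀ (Zg *ᵥ δ₀) + 2 * reDot δ₀ q + reDot w q := by
    rw [hFδ, Matrix.mulVec_add, reDot_add_left, reDot_add_right, reDot_add_right, hherm w δ₀, ← hq]
    ring
  have e3 : reDot s (P *ᵥ s) = reDot η (P *ᵥ η) + reDot (Gᴴ *ᵥ s) (Gᴴ *ᵥ s) := by
    conv_lhs => rw [hP]
    rw [Matrix.add_mulVec, reDot_add_right, ← Matrix.mulVec_mulVec, ← Matrix.mulVec_mulVec,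
      ← Matrix.mulVec_mulVec, ← hηs, reDot_mulVec F, reDot_mulVec G, ← hηs]
  have e4 : reDot ξ η = reDot ξ₀ s - reDot u (Gᴴ *ᵥ s) := by
    rw [hηs, hξ, reDot_mulVec Fᴴ, reDot_mulVec Gᴴ, Matrix.conjTranspose_conjTranspose,
      Matrix.conjTranspose_conjTranspose, reDot_add_left]
    ring
  have e5 : reDot s (P *ᵥ s) = reDot h (P *ᵥ h) + 2 * reDot (P *ᵥ h) q + reDot q (P *ᵥ q) := by
    rw [hs, Matrix.mulVec_add, reDot_add_left, reDot_add_right, reDot_add_right, hPherm h q,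
      reDot_comm (P *ᵥ h) q]
    ring
  have e6 : reDot δ₀ q = reDot (P *ᵥ h) q - reDot ξ₀ q := by rw [hδ₀, reDot_sub_left]
  have e7 : reDot ξ₀ s = reDot ξ₀ h + reDot ξ₀ q := by rw [hs, reDot_add_right]
  have e8 : 0 ≤ reDot w q - reDot q (P *ᵥ q) := by
    have h1 := posSemidef_reDot_nonneg
      (posSemidef_sub_mul_mul hPQ hPd.isHermitian hZs hR) w
    rw [Matrix.sub_mulVec, reDot_sub_right, ← hq, ← Matrix.mulVec_mulVec, ← hq,
      ← Matrix.mulVec_mulVec, reDot_mulVec Zg, hZs.isHermitian.eq, ← hq] at h1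
    exact h1
  have e9 := reDot_self_nonneg (u - Gᴴ *ᵥ s)
  rw [reDot_sub_left, reDot_sub_right, reDot_sub_right, reDot_comm (Gᴴ *ᵥ s) u] at e9
  -- The difference of the two sides is exactly |u - G*s|² + (Re w*q - q*Pq), nonnegative by `e9`
  -- and `e8`.
  have main : c⁻¹ * reDot (H *ᵥ δ) (H *ᵥ δ) ≤
      reDot u u + storage P Zg ξ η - storage P Zg ξ₀ h := by
    rw [storage, storage, ← hδ, ← hδ₀]
    linarith
  rw [← hδ]
  rwa [inv_mul_le_iff₀ hc] at main

end energy

/-! ### Impulse responses and Neumann series. -/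

section powers

variable {n m p : ℕ}

/-- The powers of `A` as a sequence supported on nonnegative times. -/
def causalPow (A : Matrix (Fin n) (Fin n) 𝕜) (k : ℤ) : Matrix (Fin n) (Fin n) 𝕜 :=
  if 0 ≤ k then A ^ k.toNat else 0

/-- The powers of `A` as a sequence supported on negative times, running backwards. -/
def anticausalPow (A : Matrix (Fin n) (Fin n) 𝕜) (k : ℤ) : Matrix (Fin n) (Fin n) 𝕜 :=
  if k < 0 then A ^ (-k - 1).toNat else 0

variable (A : Matrix (Fin n) (Fin n) 𝕜)

theorem causalPow_natCast (k : ℕ) : causalPow A k = A ^ k := by simp [causalPow]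

theorem anticausalPow_negSucc (k : ℕ) : anticausalPow A (Int.negSucc k) = A ^ k := by
  rw [anticausalPow, if_pos (by lia)]
  congr 1
  lia

theorem causalPow_step (k : ℤ) :
    causalPow A k = A * causalPow A (k - 1) + if k = 0 then 1 else 0 := by
  rcases lt_trichotomy k 0 with h | rfl | h
  · rw [causalPow, causalPow, if_neg (by lia), if_neg (by lia), if_neg (by lia)]; simp
  · simp [causalPow]
  · rw [causalPow, causalPow, if_pos (by lia), if_pos (by lia), if_neg (by lia), add_zero,
      ← pow_succ']
    congr 1
    lia

theorem anticausalPow_step (k : ℤ) :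
    anticausalPow A (k - 1) = A * anticausalPow A k + if k = 0 then 1 else 0 := by
  rcases lt_trichotomy k 0 with h | rfl | h
  · rw [anticausalPow, anticausalPow, if_pos (by lia), if_pos (by lia), if_neg (by lia), add_zero,
      ← pow_succ']
    congr 1
    lia
  · simp [anticausalPow]
  · rw [anticausalPow, anticausalPow, if_neg (by lia), if_neg (by lia), if_neg (by lia)]; simp

/-- Summation over the integers of a family supported on the nonnegative integers. -/
theorem hasSum_natCast_iff {M : Type*} [AddCommMonoid M] [TopologicalSpace M] {f : ℤ → M} {a : M}
    (h : ∀ k < 0, f k = 0) : HasSum (fun k : ℕ => f k) a ↔ HasSum f a :=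
  Function.Injective.hasSum_iff Nat.cast_injective fun k hk => h k (by
    by_contra h0
    exact hk ⟨k.toNat, by lia⟩)

/-- Summation over the integers of a family supported on the negative integers. -/
theorem hasSum_negSucc_iff {M : Type*} [AddCommMonoid M] [TopologicalSpace M] {f : ℤ → M} {a : M}
    (h : ∀ k, 0 ≤ k → f k = 0) : HasSum (fun k : ℕ => f (Int.negSucc k)) a ↔ HasSum f a :=
  Function.Injective.hasSum_iff (fun _ _ => Int.negSucc.inj) fun k hk => h k (by
    by_contra h0
    exact hk ⟨(-k - 1).toNat, by lia⟩)

variable {A}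

theorem summable_causalPow (h : Summable fun k : ℕ => A ^ k) : Summable (causalPow A) := by
  obtain ⟨S, hS⟩ := h
  refine ⟨S, (hasSum_natCast_iff fun k hk => ?_).1 ?_⟩
  · rw [causalPow, if_neg (by lia)]
  · simpa only [causalPow_natCast] using hS

theorem summable_anticausalPow (h : Summable fun k : ℕ => A ^ k) :
    Summable (anticausalPow A) := by
  obtain ⟨S, hS⟩ := h
  refine ⟨S, (hasSum_negSucc_iff fun k hk => ?_).1 ?_⟩
  · rw [anticausalPow, if_neg (by lia)]
  · simpa only [anticausalPow_negSucc] using hS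

/-- Neumann series (z⁻¹ - F)⁻¹ = z ∑ (zF)ᵏ; the extra z puts HFᵏG on diagonal -k-1, that is
`Int.negSucc k`. -/
theorem hasSum_anticausalTransfer {F : Matrix (Fin n) (Fin n) 𝕜} (hF : IsStable F)
    (G : Matrix (Fin n) (Fin m) 𝕜) (H : Matrix (Fin p) (Fin n) 𝕜) {z : ℂ} (hz : ‖z‖ = 1) :
    HasSum (fun k : ℤ => z ^ (-k) • toC (H * anticausalPow F k * G))
      (anticausalTransfer F G H z) := by
  have hz0 : z ≠ 0 := by rintro rfl; simp at hz
  obtain ⟨S, hS⟩ := summable_pow_smul (summable_pow_complex hF) hz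
  have h1 := one_sub_mul_of_hasSum_pow hS
  have h2 : (z⁻¹ • (1 : Matrix (Fin n) (Fin n) ℂ) - toC F)⁻¹ = z • S := by
    refine Matrix.inv_eq_right_inv ?_
    refine Eq.trans ?_ h1
    rw [sub_mul, sub_mul, smul_mul_smul_comm, inv_mul_cancel₀ hz0, one_smul, one_mul,
      smul_mul_assoc, mul_smul_comm]
  rw [← hasSum_negSucc_iff fun k hk => ?_, anticausalTransfer, h2]
  · convert hasSum_mul_right (toC G) (hasSum_mul_left (toC H) (hS.const_smul z)) using 2 with k
    rw [anticausalPow_negSucc, toC_mul, toC_mul, toC_pow, smul_pow, smul_smul, Matrix.mul_smul,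
      Matrix.smul_mul, Int.neg_negSucc, zpow_natCast, pow_succ']
  · rw [anticausalPow, if_neg (by lia)]; simp [toC_zero]

/-- The middle factor collapses to ∑ z⁻ᵏAᵏ. -/
theorem hasSum_causal_resolvent {A : Matrix (Fin n) (Fin n) 𝕜} (hA : IsStable A)
    (K : Matrix (Fin n) (Fin m) 𝕜) (C : Matrix (Fin p) (Fin n) 𝕜) {z : ℂ} (hz : ‖z‖ = 1) :
    HasSum (fun k : ℤ => z ^ (-k) • toC (C * causalPow A k * K))
      (toC C * (1 + toC A * (z • (1 : Matrix (Fin n) (Fin n) ℂ) - toC A)⁻¹) * toC K) := by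
  have hz0 : z ≠ 0 := by rintro rfl; simp at hz
  obtain ⟨S, hS⟩ := summable_pow_smul (summable_pow_complex hA) (z := z⁻¹) (by simp [hz])
  have h1 := one_sub_mul_of_hasSum_pow hS
  have h2 : (z • (1 : Matrix (Fin n) (Fin n) ℂ) - toC A)⁻¹ = z⁻¹ • S := by
    refine Matrix.inv_eq_right_inv ?_
    refine Eq.trans ?_ h1
    rw [sub_mul, sub_mul, smul_mul_smul_comm, mul_inv_cancel₀ hz0, one_smul, one_mul,
      smul_mul_assoc, mul_smul_comm]
  have h3 : 1 + toC A * (z⁻¹ • S) = S := by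
    nth_rewrite 1 [← h1]
    rw [sub_mul, one_mul, smul_mul_assoc, mul_smul_comm]
    abel
  rw [← hasSum_natCast_iff fun k hk => ?_, h2, h3]
  · convert hasSum_mul_right (toC K) (hasSum_mul_left (toC C) hS) using 2 with k
    rw [causalPow_natCast, toC_mul, toC_mul, toC_pow, smul_pow, Matrix.mul_smul,
      Matrix.smul_mul, zpow_neg, zpow_natCast, inv_pow]
  · rw [causalPow, if_neg (by lia)]; simp [toC_zero]

end powers

/-! ### Finitely supported signals. -/

section finite

variable {m p : ℕ}

theorem apply_single (A : Op 𝕜 m p) (i j : ℤ) (x : EuclideanSpace 𝕜 (Fin m)) :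
    ((A (lp.single 2 j x)) i).ofLp = block A i j *ᵥ x.ofLp := by
  have hx : x = ∑ b, x b • EuclideanSpace.single b (1 : 𝕜) := by
    ext b; simp [Pi.single_apply]
  have h1 : (lp.single 2 j x : Signal 𝕜 m) =
      ∑ b, x b • lp.single 2 j (EuclideanSpace.single b (1 : 𝕜)) := by
    conv_lhs => rw [hx]
    change lp.lsingle (𝕜 := 𝕜) (E := fun _ : ℤ => EuclideanSpace 𝕜 (Fin m)) 2 j _ = _
    rw [map_sum]
    exact Finset.sum_congr rfl fun b _ => map_smul _ _ _
  rw [h1, map_sum, lp.coeFn_sum]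
  ext a
  simp [Matrix.mulVec, dotProduct, block, mul_comm]

/-- The finitely supported signal with values `x j` for `j ∈ s`. -/
def finSignal (s : Finset ℤ) (x : ℤ → Fin m → 𝕜) : Signal 𝕜 m :=
  ∑ j ∈ s, lp.single 2 j (WithLp.toLp 2 (x j))

theorem apply_finSignal (A : Op 𝕜 m p) (s : Finset ℤ) (x : ℤ → Fin m → 𝕜) (i : ℤ) :
    ((A (finSignal s x)) i).ofLp = ∑ j ∈ s, block A i j *ᵥ x j := by
  rw [finSignal, map_sum, lp.coeFn_sum, Finset.sum_apply, WithLp.ofLp_sum]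
  exact Finset.sum_congr rfl fun j _ => apply_single A i j _

theorem norm_finSignal_sq (s : Finset ℤ) (x : ℤ → Fin m → 𝕜) :
    ‖finSignal s x‖ ^ 2 = ∑ j ∈ s, reDot (x j) (x j) := by
  have h := lp.norm_sum_single (p := 2) (E := fun _ : ℤ => EuclideanSpace 𝕜 (Fin m)) (by simp)
    (fun j => WithLp.toLp 2 (x j)) s
  simp only [ENNReal.toReal_ofNat, Real.rpow_ofNat] at h
  rw [finSignal, h]
  exact Finset.sum_congr rfl fun j _ => (reDot_self_ofLp _).symm

/-- Finitely supported signals are dense. -/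
theorem opNorm_le_of_finSignal {A : Op 𝕜 m p} {C : ℝ} (hC : 0 ≤ C)
    (h : ∀ (s : Finset ℤ) (x : ℤ → Fin m → 𝕜), ‖A (finSignal s x)‖ ≤ C * ‖finSignal s x‖) :
    ‖A‖ ≤ C := by
  refine ContinuousLinearMap.opNorm_le_bound _ hC fun u => ?_
  have h1 : HasSum (fun j => lp.single 2 j (u j)) u := lp.hasSum_single (by simp) u
  have h2 : Filter.Tendsto (fun s : Finset ℤ => finSignal s fun j => (u j).ofLp) Filter.atTop
      (nhds u) := h1
  exact le_of_tendsto_of_tendsto ((A.continuous.tendsto u).comp h2).norm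
    (h2.norm.const_mul C) (Filter.Eventually.of_forall fun s => h s _)

theorem sum_Ioc_sub (f : ℤ → ℝ) {a b : ℤ} (h : a ≤ b) :
    ∑ i ∈ Finset.Ioc a b, (f i - f (i - 1)) = f b - f a := by
  induction b, h using Int.leInduction with
  | base => simp
  | succ b hb ih =>
    have : Finset.Ioc a (b + 1) = insert (b + 1) (Finset.Ioc a b) := by
      ext; simp only [Finset.mem_Ioc, Finset.mem_insert]; lia
    rw [this, Finset.sum_insert (by simp), ih]
    simp

end finite

/-! ### Upper and lower bounds for the error norm. -/

section bounds

variable {n m p : ℕ} {F P : Matrix (Fin n) (Fin n) 𝕜}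
  {G : Matrix (Fin n) (Fin m) 𝕜} {H : Matrix (Fin p) (Fin n) 𝕜} {T L : Op 𝕜 m p}

theorem block_sub (A B : Op 𝕜 m p) (i j : ℤ) : block (A - B) i j = block A i j - block B i j := by
  ext; simp [block]

theorem reDot_sum_right {ι : Type*} (s : Finset ι) (x : Fin n → 𝕜) (y : ι → Fin n → 𝕜) :
    reDot x (∑ i ∈ s, y i) = ∑ i ∈ s, reDot x (y i) := by
  simp [reDot, dotProduct_sum]

theorem tendsto_state_zero {a : ℤ → Matrix (Fin n) (Fin n) 𝕜} (ha : Summable a) (s : Finset ℤ)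
    (K : Matrix (Fin n) (Fin m) 𝕜) (x : ℤ → Fin m → 𝕜) :
    Filter.Tendsto (fun i => ∑ j ∈ s, (a (i - j) * K) *ᵥ x j) Filter.cofinite (nhds 0) := by
  rw [← Finset.sum_const_zero (s := s) (ι := ℤ)]
  refine tendsto_finsetSum _ fun j _ => ?_
  have h1 : Continuous fun A : Matrix (Fin n) (Fin n) 𝕜 => (A * K) *ᵥ x j :=
    (continuous_id.matrix_mul continuous_const).matrix_mulVec continuous_const
  have h2 := ha.tendsto_cofinite_zero.comp
    (Equiv.subRight j).injective.tendsto_cofinite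
  have h3 := (h1.tendsto 0).comp h2
  rwa [Matrix.zero_mul, Matrix.zero_mulVec] at h3

theorem sum_step {a b : ℤ → Matrix (Fin n) (Fin n) 𝕜} {A : Matrix (Fin n) (Fin n) 𝕜}
    (h : ∀ k, b k = A * a k + if k = 0 then 1 else 0) (s : Finset ℤ)
    (K : Matrix (Fin n) (Fin m) 𝕜) (x : ℤ → Fin m → 𝕜) (i : ℤ) :
    ∑ j ∈ s, (b (i - j) * K) *ᵥ x j =
      A *ᵥ (∑ j ∈ s, (a (i - j) * K) *ᵥ x j) + K *ᵥ (if i ∈ s then x i else 0) := by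
  have h1 : ∀ j, (b (i - j) * K) *ᵥ x j =
      A *ᵥ ((a (i - j) * K) *ᵥ x j) + if i = j then K *ᵥ x i else 0 := by
    intro j
    rw [h, Matrix.add_mul, Matrix.add_mulVec, Matrix.mulVec_mulVec, Matrix.mul_assoc]
    congr 1
    by_cases hij : i = j
    · subst hij; simp
    · simp [hij, sub_eq_zero]
  simp only [h1, Finset.sum_add_distrib, Finset.sum_ite_eq]
  rw [Matrix.mulVec_sum]
  congr 1
  split_ifs <;> simp

/-- The error of the central solution at level `c` has norm at most `√c`. -/
theorem norm_error_sq_le {Zg : Matrix (Fin n) (Fin n) 𝕜} {c : ℝ} (hc : 0 < c)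
    (hF : IsStable F) (hu : IsUnit (1 - Fᴴ * Zg * F * P)) (hPd : P.PosDef)
    (hP : P = F * P * Fᴴ + G * Gᴴ) (hZ : Zg = Fᴴ * Zg * F + c⁻¹ • (Hᴴ * H))
    (hZs : Zg.PosSemidef) (hR : (P⁻¹ - Zg).PosSemidef)
    (hT : ∀ i j, block T i j = H * anticausalPow F (i - j) * G)
    (hL : ∀ i j, block L i j = H * P * causalPow (stateF F G P Zg) (i - j) * gainK F G P Zg) :
    ‖L - T‖ ^ 2 ≤ c := by
  have hA := isStable_stateF (inv_pos.2 hc) hF hPd hP hZ hR hu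
  suffices ‖L - T‖ ≤ √c by
    rw [← Real.sq_sqrt hc.le]
    exact pow_le_pow_left₀ (norm_nonneg _) this 2
  refine opNorm_le_of_finSignal (Real.sqrt_nonneg c) fun s x => ?_
  set η : ℤ → Fin n → 𝕜 := fun i =>
    ∑ j ∈ s, (causalPow (stateF F G P Zg) (i - j) * gainK F G P Zg) *ᵥ x j with hη
  set ξ : ℤ → Fin n → 𝕜 := fun i => ∑ j ∈ s, (anticausalPow F (i - j) * G) *ᵥ x j with hξ
  set u : ℤ → Fin m → 𝕜 := fun i => if i ∈ s then x i else 0 with hu'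
  set V : ℤ → ℝ := fun i => storage P Zg (ξ i) (η i) with hV
  have hηstep : ∀ i, η i = stateF F G P Zg *ᵥ η (i - 1) + gainK F G P Zg *ᵥ u i := by
    intro i
    have h1 := sum_step (causalPow_step (stateF F G P Zg)) s (gainK F G P Zg) x i
    simp only [hη, hu', h1, sub_right_comm]
  have hξstep : ∀ i, ξ (i - 1) = F *ᵥ ξ i + G *ᵥ u i := by
    intro i
    have h1 := sum_step (anticausalPow_step F) s G x i
    simp only [hξ, hu', ← h1, sub_right_comm]
  have herr : ∀ i, (((L - T) (finSignal s x)) i).ofLp = H *ᵥ (P *ᵥ η i - ξ i) := by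
    intro i
    rw [apply_finSignal, Matrix.mulVec_sub, Matrix.mulVec_mulVec, hη, hξ]
    simp only [Matrix.mulVec_sum, ← Finset.sum_sub_distrib]
    refine Finset.sum_congr rfl fun j _ => ?_
    rw [block_sub, Matrix.sub_mulVec, hL, hT, Matrix.mulVec_mulVec, Matrix.mulVec_mulVec,
      Matrix.mul_assoc (H * P), Matrix.mul_assoc H (anticausalPow _ _)]
  have hdis : ∀ i, ‖((L - T) (finSignal s x)) i‖ ^ 2 ≤
      c * (reDot (u i) (u i) + (V i - V (i - 1))) := by
    intro i
    rw [← reDot_self_ofLp, herr, ← add_sub_assoc]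
    exact dissipation hc hu hPd hP hZ hZs hR (hηstep i) (hξstep i)
  -- Cofinite convergence treats both ends of the time axis at once; stability of F controls ξ and
  -- stability of F_γ controls η.
  have hVlim : Filter.Tendsto V Filter.cofinite (nhds 0) := by
    have h1 := (tendsto_state_zero (summable_anticausalPow hF.summable_pow) s G x).prodMk_nhds
      (tendsto_state_zero (summable_causalPow hA.summable_pow) s (gainK F G P Zg) x)
    have h2 := ((continuous_storage P Zg).tendsto (0, 0)).comp h1
    simp only [storage_zero] at h2
    exact h2
  have hlim : Filter.Tendsto (fun N : ℕ => c * (∑ j ∈ s, reDot (x j) (x j) + (V N - V (-N))))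
      Filter.atTop (nhds (c * ∑ j ∈ s, reDot (x j) (x j))) := by
    have h1 : Filter.Tendsto (fun N : ℕ => (N : ℤ)) Filter.atTop Filter.cofinite := by
      rw [← Nat.cofinite_eq_atTop]; exact Nat.cast_injective.tendsto_cofinite
    have h2 : Filter.Tendsto (fun N : ℕ => -(N : ℤ)) Filter.atTop Filter.cofinite :=
      neg_injective.tendsto_cofinite.comp h1
    simpa using (((hVlim.comp h1).sub (hVlim.comp h2)).const_add
      (∑ j ∈ s, reDot (x j) (x j))).const_mul c
  refine signal_norm_le (by positivity) fun t => ?_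
  rw [mul_pow, Real.sq_sqrt hc.le, norm_finSignal_sq]
  refine ge_of_tendsto hlim ?_
  obtain ⟨N₀, hN₀⟩ : ∃ N₀ : ℕ, ∀ i ∈ t, i.natAbs < N₀ := by
    refine ⟨t.sup Int.natAbs + 1, fun i hi => Nat.lt_succ_of_le (Finset.le_sup (f := Int.natAbs) hi)⟩
  filter_upwards [Filter.eventually_ge_atTop N₀] with N hN
  -- The interval is half-open so that increments telescope to V(N) - V(-N); the strict bound on
  -- `natAbs` keeps -N out of `t`.
  have hsub : t ⊆ Finset.Ioc (-(N : ℤ)) N := by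
    intro i hi
    have := hN₀ i hi
    rw [Finset.mem_Ioc]
    lia
  calc ∑ i ∈ t, ‖((L - T) (finSignal s x)) i‖ ^ 2
      ≤ ∑ i ∈ Finset.Ioc (-(N : ℤ)) N, ‖((L - T) (finSignal s x)) i‖ ^ 2 :=
        Finset.sum_le_sum_of_subset_of_nonneg hsub fun _ _ _ => by positivity
    _ ≤ ∑ i ∈ Finset.Ioc (-(N : ℤ)) N, c * (reDot (u i) (u i) + (V i - V (i - 1))) :=
        Finset.sum_le_sum fun i _ => hdis i
    _ = c * (∑ i ∈ Finset.Ioc (-(N : ℤ)) N, reDot (u i) (u i) + (V N - V (-N))) := by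
        rw [← Finset.mul_sum, Finset.sum_add_distrib, sum_Ioc_sub V (by lia)]
    _ ≤ c * (∑ j ∈ s, reDot (x j) (x j) + (V N - V (-N))) := by
        gcongr
        have h1 : ∀ i, reDot (u i) (u i) = if i ∈ s then reDot (x i) (x i) else 0 := by
          intro i
          by_cases hi : i ∈ s
          · simp [hu', hi]
          · simp [hu', hi, reDot]
        simp only [h1]
        rw [← Finset.sum_filter]
        exact Finset.sum_le_sum_of_subset_of_nonneg
          (fun i hi => (Finset.mem_filter.1 hi).2) fun _ _ _ => reDot_self_nonneg _

/-- The Hankel lower bound for the approximation error of a causal operator. -/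
theorem le_norm_error_sq {Z : Matrix (Fin n) (Fin n) 𝕜} {c : ℝ} (hF : Summable fun k : ℕ => F ^ k)
    (hZ : Z = Fᴴ * Z * F + Hᴴ * H) (hPd : P.PosDef) (hP : P = F * P * Fᴴ + G * Gᴴ)
    (hT : ∀ i j, block T i j = H * anticausalPow F (i - j) * G) (hL : IsCausal L)
    {w : Fin n → 𝕜} (hw : w ≠ 0) (hc : (Z * P) *ᵥ w = c • w) : c ≤ ‖L - T‖ ^ 2 := by
  have hP' : P = Fᴴᴴ * P * Fᴴ + G * Gᴴ := by rwa [Matrix.conjTranspose_conjTranspose]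
  set PN : ℕ → Matrix (Fin n) (Fin n) 𝕜 := fun N =>
    ∑ k ∈ Finset.range N, F ^ k * (G * Gᴴ) * Fᴴ ^ k with hPN
  have hlim : Filter.Tendsto PN Filter.atTop (nhds P) := by
    have := tendsto_lyapunov_sum (summable_pow_conjTranspose hF) hP'
    simpa only [Matrix.conjTranspose_conjTranspose] using this
  -- N truncates the input and M the observed output; P is replaced by its partial sum until both
  -- limits are taken.
  have hfin : ∀ N M : ℕ, ∑ k ∈ Finset.range M,
      reDot ((H * F ^ k) *ᵥ (PN N *ᵥ w)) ((H * F ^ k) *ᵥ (PN N *ᵥ w)) ≤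
        ‖L - T‖ ^ 2 * reDot w (PN N *ᵥ w) := by
    intro N M
    set s : Finset ℤ := (Finset.range N).map Nat.castEmbedding with hs
    -- This input steers the backward state at time -1 to P_N w, at energy w*P_N w.
    set x : ℤ → Fin m → 𝕜 := fun j => (Gᴴ * Fᴴ ^ j.toNat) *ᵥ w with hx
    have hu : ‖finSignal s x‖ ^ 2 = reDot w (PN N *ᵥ w) := by
      rw [norm_finSignal_sq, hs, Finset.sum_map, hPN, Matrix.sum_mulVec, reDot_sum_right]
      refine Finset.sum_congr rfl fun j _ => ?_
      simp only [hx, Nat.castEmbedding_apply, Int.toNat_natCast]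
      rw [← reDot_conjTranspose_mul_self, Matrix.conjTranspose_mul,
        Matrix.conjTranspose_conjTranspose, ← Matrix.conjTranspose_pow,
        Matrix.conjTranspose_conjTranspose]
      simp only [Matrix.mul_assoc]
    have he : ∀ k : ℕ, (((L - T) (finSignal s x)) (Int.negSucc k)).ofLp =
        -((H * F ^ k) *ᵥ (PN N *ᵥ w)) := by
      intro k
      rw [apply_finSignal, hs, Finset.sum_map, hPN, Matrix.sum_mulVec, Matrix.mulVec_sum,
        ← Finset.sum_neg_distrib]
      refine Finset.sum_congr rfl fun j _ => ?_
      have hidx : Int.negSucc k - (j : ℤ) = Int.negSucc (k + j) := by lia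
      simp only [hx, Nat.castEmbedding_apply, Int.toNat_natCast]
      rw [block_sub, hL _ _ (by lia), hT, hidx, anticausalPow_negSucc, zero_sub, Matrix.neg_mulVec,
        Matrix.mulVec_mulVec, Matrix.mulVec_mulVec, pow_add]
      simp only [Matrix.mul_assoc]
    rw [← hu, ← mul_pow]
    have h1 : ∑ k ∈ Finset.range M,
        reDot ((H * F ^ k) *ᵥ (PN N *ᵥ w)) ((H * F ^ k) *ᵥ (PN N *ᵥ w)) =
        ∑ i ∈ (Finset.range M).map ⟨Int.negSucc, fun _ _ => Int.negSucc.inj⟩,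
          ‖((L - T) (finSignal s x)) i‖ ^ 2 := by
      rw [Finset.sum_map]
      refine Finset.sum_congr rfl fun k _ => ?_
      change _ = ‖((L - T) (finSignal s x)) (Int.negSucc k)‖ ^ 2
      rw [← reDot_self_ofLp, he]
      simp [reDot]
    rw [h1]
    refine ((signal_summable_sq _).sum_le_tsum _ fun _ _ => by positivity).trans ?_
    rw [← signal_norm_sq]
    exact pow_le_pow_left₀ (norm_nonneg _) ((L - T).le_opNorm _) 2
  have hN : ∀ N : ℕ, reDot (PN N *ᵥ w) (Z *ᵥ (PN N *ᵥ w)) ≤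
      ‖L - T‖ ^ 2 * reDot w (PN N *ᵥ w) := by
    intro N
    have h1 := (tendsto_reDot_pow hF Z (PN N *ᵥ w)).const_sub
      (reDot (PN N *ᵥ w) (Z *ᵥ (PN N *ᵥ w)))
    rw [sub_zero] at h1
    refine le_of_tendsto' h1 fun M => ?_
    rw [reDot_lyapunov_iterate hZ (PN N *ᵥ w) M, add_sub_cancel_right]
    exact hfin N M
  have hcont : Continuous fun A : Matrix (Fin n) (Fin n) 𝕜 => A *ᵥ w :=
    continuous_id.matrix_mulVec continuous_const
  have hcont1 : Continuous fun A : Matrix (Fin n) (Fin n) 𝕜 => reDot (A *ᵥ w) (Z *ᵥ (A *ᵥ w)) :=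
    continuous_reDot.comp (hcont.prodMk (continuous_const.matrix_mulVec hcont))
  have hcont2 : Continuous fun A : Matrix (Fin n) (Fin n) 𝕜 => ‖L - T‖ ^ 2 * reDot w (A *ᵥ w) :=
    continuous_const.mul (continuous_reDot.comp (continuous_const.prodMk hcont))
  have hle := le_of_tendsto_of_tendsto' ((hcont1.tendsto P).comp hlim)
    ((hcont2.tendsto P).comp hlim) hN
  -- In the limit, the eigenvector equation turns the output energy into c·w*Pw, and w*Pw > 0
  -- cancels.
  rw [Matrix.mulVec_mulVec, hc, reDot_smul_right, reDot_comm (P *ᵥ w) w] at hle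
  exact le_of_mul_le_mul_right hle (reDot_pos hPd hw)

end bounds

/-! ### Weak compactness and existence of a minimizer. -/

section attainment

variable {m p : ℕ}

/-- Bounded sequences of operators between Hilbert spaces have weak limits along ultrafilters. -/
theorem exists_weak_limit {E E' : Type*} [NormedAddCommGroup E] [InnerProductSpace 𝕜 E]
    [NormedAddCommGroup E'] [InnerProductSpace 𝕜 E'] [CompleteSpace E'] {ι : Type*}
    (U : Ultrafilter ι) (A : ι → E →L[𝕜] E') {C : ℝ} (hC : 0 ≤ C)
    (hA : ∀ s, ‖A s‖ ≤ C) :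
    ∃ B : E →L[𝕜] E', ∀ x y, Filter.Tendsto (fun s => inner 𝕜 (A s x) y) U
      (nhds (inner 𝕜 (B x) y)) := by
  have hbound : ∀ s x y, ‖inner 𝕜 (A s x) y‖ ≤ C * ‖x‖ * ‖y‖ := fun s x y =>
    (norm_inner_le_norm _ _).trans (mul_le_mul_of_nonneg_right
      (((A s).le_opNorm x).trans (mul_le_mul_of_nonneg_right (hA s) (norm_nonneg _)))
      (norm_nonneg _))
  have hex : ∀ x y, ∃ l, Filter.Tendsto (fun s => inner 𝕜 (A s x) y) U (nhds l) := by
    intro x y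
    -- For fixed x and y the scalars stay in a compact ball, so the ultrafilter converges; Riesz
    -- representation then assembles the limits into an operator.
    obtain ⟨l, -, hl⟩ := (isCompact_closedBall (0 : 𝕜) (C * ‖x‖ * ‖y‖)).ultrafilter_le_nhds
      (U.map fun s => inner 𝕜 (A s x) y) (by
        rw [Filter.le_principal_iff]
        exact Filter.Eventually.of_forall (f := (U : Filter ι)) fun s => by
          simpa using hbound s x y)
    exact ⟨l, hl⟩
  choose f hf using hex
  have hfb : ∀ x y, ‖f x y‖ ≤ C * ‖x‖ * ‖y‖ := fun x y =>
    le_of_tendsto' (hf x y).norm fun s => hbound s x y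
  let φ : E → E' →L[𝕜] 𝕜 := fun x => LinearMap.mkContinuous
    { toFun := f x
      map_add' := fun y z => tendsto_nhds_unique (hf x (y + z)) (by
        simpa only [inner_add_right] using (hf x y).add (hf x z))
      map_smul' := fun c y => tendsto_nhds_unique (hf x (c • y)) (by
        simpa only [inner_smul_right, RingHom.id_apply, smul_eq_mul] using (hf x y).const_mul c) } (C * ‖x‖) (hfb x)
  let b : E → E' := fun x => (InnerProductSpace.toDual 𝕜 E').symm (φ x)
  have hb : ∀ x y, inner 𝕜 (b x) y = f x y := fun x y =>
    InnerProductSpace.toDual_symm_apply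
  refine ⟨LinearMap.mkContinuous
    { toFun := b
      map_add' := fun x z => ext_inner_right 𝕜 fun y => ?_
      map_smul' := fun c x => ext_inner_right 𝕜 fun y => ?_ } C fun x => ?_, fun x y => ?_⟩
  · rw [inner_add_left, hb, hb, hb]
    refine tendsto_nhds_unique (hf (x + z) y) ?_
    simpa only [map_add, inner_add_left] using (hf x y).add (hf z y)
  · rw [RingHom.id_apply, inner_smul_left, hb, hb]
    refine tendsto_nhds_unique (hf (c • x) y) ?_
    simpa only [map_smul, inner_smul_left] using (hf x y).const_mul _
  · change ‖(InnerProductSpace.toDual 𝕜 E').symm (φ x)‖ ≤ _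
    rw [LinearIsometryEquiv.norm_map]
    exact LinearMap.mkContinuous_norm_le _ (by positivity) _
  · change Filter.Tendsto _ _ (nhds (inner 𝕜 (b x) y))
    rw [hb]
    exact hf x y

/-- A minimizing sequence of causal block Toeplitz approximants has a causal block Toeplitz weak
limit. -/
theorem exists_optimal {T : Op 𝕜 m p} {γ : ℝ} (hγ : 0 ≤ γ)
    (h : ∀ c, γ < c → ∃ L : Op 𝕜 m p, IsBlockToeplitz L ∧ IsCausal L ∧ ‖L - T‖ ≤ c) :
    ∃ L : Op 𝕜 m p, IsBlockToeplitz L ∧ IsCausal L ∧ ‖L - T‖ ≤ γ := by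
  choose! A hA using h
  let U : Ultrafilter ℕ := Filter.hyperfilter ℕ
  have hUle : (U : Filter ℕ) ≤ Filter.atTop := Nat.hyperfilter_le_atTop
  let c : ℕ → ℝ := fun s => γ + 1 / ((s : ℝ) + 1)
  have hc : ∀ s, γ < c s := fun s => lt_add_of_pos_right _ (by positivity)
  have hc1 : ∀ s, c s ≤ γ + 1 := fun s => by
    have : 1 / ((s : ℝ) + 1) ≤ 1 := by
      rw [div_le_one (by positivity)]; linarith [Nat.cast_nonneg (α := ℝ) s]
    simp only [c]; linarith
  have hclim : Filter.Tendsto c U (nhds γ) := by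
    have h1 := (tendsto_one_div_add_atTop_nhds_zero_nat (𝕜 := ℝ)).const_add γ
    rw [add_zero] at h1
    exact h1.mono_left hUle
  obtain ⟨B, hB⟩ := exists_weak_limit U (fun s => A (c s) - T)
    (C := γ + 1) (by positivity) (fun s => ((hA _ (hc s)).2.2).trans (hc1 s))
  -- Block entries are inner products with basis signals, so weak limits preserve the Toeplitz and
  -- causality constraints.
  have hentry : ∀ (D : Op 𝕜 m p) i j a b, block D i j a b = star (inner 𝕜
      (D (lp.single 2 j (EuclideanSpace.single b (1 : 𝕜))))
      (lp.single 2 i (EuclideanSpace.single a (1 : 𝕜)) : Signal 𝕜 p)) := by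
    intro D i j a b
    rw [lp.inner_single_right]
    simp [block, EuclideanSpace.inner_single_left]
  have hblock : ∀ i j a b, Filter.Tendsto (fun s => block (A (c s) - T) i j a b) U
      (nhds (block B i j a b)) := by
    intro i j a b
    simp only [hentry]
    exact (continuous_star.tendsto _).comp (hB _ _)
  have hadd : ∀ i j, block (B + T) i j = block B i j + block T i j := by
    intro i j; ext; simp [block]
  have hblock' : ∀ i j a b, Filter.Tendsto (fun s => block (A (c s)) i j a b) U
      (nhds (block (B + T) i j a b)) := by
    intro i j a b
    rw [hadd]
    refine ((hblock i j a b).add_const (block T i j a b)).congr fun s => ?_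
    rw [block_sub, Matrix.sub_apply, sub_add_cancel]
  refine ⟨B + T, fun i j => ?_, fun i j hij => ?_, ?_⟩
  · ext a b
    refine tendsto_nhds_unique (hblock' (i + 1) (j + 1) a b) ?_
    simpa only [(hA _ (hc _)).1 i j] using hblock' i j a b
  · ext a b
    refine tendsto_nhds_unique (hblock' i j a b) ?_
    simp only [(hA _ (hc _)).2.1 i j hij]
    exact tendsto_const_nhds
  · rw [add_sub_cancel_right]
    refine ContinuousLinearMap.opNorm_le_bound _ hγ fun x => ?_
    -- Weak lower semicontinuity of the norm, by testing against y = Bx.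
    have h1 := (hB x (B x)).norm
    have h2 : ‖inner 𝕜 (B x) (B x)‖ ≤ γ * ‖x‖ * ‖B x‖ := by
      refine le_of_tendsto_of_tendsto' h1 ((hclim.mul_const ‖x‖).mul_const ‖B x‖) fun s => ?_
      refine (norm_inner_le_norm _ _).trans (mul_le_mul_of_nonneg_right ?_ (norm_nonneg _))
      exact ((A (c s) - T).le_opNorm x).trans
        (mul_le_mul_of_nonneg_right (hA _ (hc s)).2.2 (norm_nonneg _))
    rw [inner_self_eq_norm_sq_to_K, norm_pow, RCLike.norm_ofReal, abs_norm, sq] at h2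
    by_cases h0 : ‖B x‖ = 0
    · rw [h0]; positivity
    · exact le_of_mul_le_mul_right h2 (lt_of_le_of_ne (norm_nonneg _) (Ne.symm h0))

end attainment

/-! ### The central solution at and above the optimal level. -/

section central

variable {n m p : ℕ} {F P Z : Matrix (Fin n) (Fin n) 𝕜}
  {G : Matrix (Fin n) (Fin m) 𝕜} {H : Matrix (Fin p) (Fin n) 𝕜} {T : Op 𝕜 m p}

theorem smul_lyapunov (hZ : Z = Fᴴ * Z * F + Hᴴ * H) (c : ℝ) :
    c • Z = Fᴴ * (c • Z) * F + c • (Hᴴ * H) := by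
  conv_lhs => rw [hZ]
  simp [smul_add]

/-- The central solution at level `c` exists as a bounded causal operator. -/
theorem exists_central {Zg : Matrix (Fin n) (Fin n) 𝕜} {c : ℝ} (hc : 0 < c)
    (hF : IsStable F) (hu : IsUnit (1 - Fᴴ * Zg * F * P)) (hPd : P.PosDef)
    (hP : P = F * P * Fᴴ + G * Gᴴ) (hZ : Zg = Fᴴ * Zg * F + c⁻¹ • (Hᴴ * H))
    (hZs : Zg.PosSemidef) (hR : (P⁻¹ - Zg).PosSemidef)
    (hT : ∀ i j, block T i j = H * anticausalPow F (i - j) * G) :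
    ∃ L : Op 𝕜 m p, IsCausal L ∧ HasTransferFunction L (solutionTransfer F G H P Zg) ∧
      ‖L - T‖ ^ 2 ≤ c := by
  have hA := isStable_stateF (inv_pos.2 hc) hF hPd hP hZ hR hu
  have hs : Summable fun k : ℤ =>
      H * P * causalPow (stateF F G P Zg) k * gainK F G P Zg :=
    summable_mul_mul (summable_causalPow hA.summable_pow) _ _
  refine ⟨toeplitzOp _, fun i j hij => ?_, hasTransferFunction_toeplitzOp hs fun z hz => ?_,
    norm_error_sq_le hc hF hu hPd hP hZ hZs hR hT fun i j => block_toeplitzOp hs i j⟩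
  · rw [block_toeplitzOp hs, causalPow, if_neg (by lia)]
    simp
  · rw [solutionTransfer, ← toC_mul]
    exact hasSum_causal_resolvent hA _ _ hz

/-- The matrix factors as (P⁻¹ - Zg + cH*H)P, a product of two positive definite matrices. -/
theorem isUnit_one_sub {Zg : Matrix (Fin n) (Fin n) 𝕜} {c : ℝ} (hc : 0 ≤ c) (hPd : P.PosDef)
    (hZ : Zg = Fᴴ * Zg * F + c • (Hᴴ * H)) (hR : (P⁻¹ - Zg).PosDef) :
    IsUnit (1 - Fᴴ * Zg * F * P) := by
  have h1 : P⁻¹ * P = 1 :=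
    Matrix.nonsing_inv_mul _ ((Matrix.isUnit_iff_isUnit_det _).1 hPd.isUnit)
  have h2 : P⁻¹ - Fᴴ * Zg * F = (P⁻¹ - Zg) + c • (Hᴴ * H) := by
    rw [sub_add, sub_right_inj, eq_sub_iff_add_eq]
    exact hZ.symm
  have h3 : (P⁻¹ - Fᴴ * Zg * F).PosDef := by
    rw [h2]
    exact hR.add_posSemidef ((Matrix.posSemidef_conjTranspose_mul_self H).smul hc)
  have h4 : 1 - Fᴴ * Zg * F * P = (P⁻¹ - Fᴴ * Zg * F) * P := by rw [sub_mul, h1]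
  rw [h4]
  exact h3.isUnit.mul hPd.isUnit

/-- Raising the level adds a positive multiple of Z > 0 to the gap P⁻¹ - γ⁻²Z ≥ 0, making it
definite, so the central formula applies. -/
theorem exists_suboptimal {γ c : ℝ} (hγ : 0 < γ) (hγc : γ < c) (hF : IsStable F) (hPd : P.PosDef)
    (hZd : Z.PosDef) (hP : P = F * P * Fᴴ + G * Gᴴ) (hZ : Z = Fᴴ * Z * F + Hᴴ * H)
    (hR : (P⁻¹ - (γ ^ 2)⁻¹ • Z).PosSemidef)
    (hT : ∀ i j, block T i j = H * anticausalPow F (i - j) * G) :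
    ∃ L : Op 𝕜 m p, IsBlockToeplitz L ∧ IsCausal L ∧ ‖L - T‖ ≤ c := by
  have hc : 0 < c := hγ.trans hγc
  have hR' : (P⁻¹ - (c ^ 2)⁻¹ • Z).PosDef := by
    have h1 : P⁻¹ - (c ^ 2)⁻¹ • Z =
        (P⁻¹ - (γ ^ 2)⁻¹ • Z) + ((γ ^ 2)⁻¹ - (c ^ 2)⁻¹) • Z := by
      rw [sub_smul]; abel
    rw [h1]
    refine Matrix.PosDef.posSemidef_add hR (hZd.smul (sub_pos.2 ?_))
    exact inv_strictAnti₀ (by positivity) (pow_lt_pow_left₀ hγc hγ.le two_ne_zero)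
  have hZ' := smul_lyapunov hZ (c ^ 2)⁻¹
  obtain ⟨L, hL1, hL2, hL3⟩ := exists_central (T := T) (by positivity : 0 < c ^ 2) hF
    (isUnit_one_sub (by positivity) hPd hZ' hR') hPd hP hZ'
    (hZd.posSemidef.smul (by positivity)) hR'.posSemidef hT
  exact ⟨L, hL2.1, hL1, (pow_le_pow_iff_left₀ (norm_nonneg _) hc.le two_ne_zero).1 hL3⟩

end central

end Nehari

end

/-! ### Assembly of the theorem. -/

open Nehari in
theorem theorem5 {𝕜 : Type*} [RCLike 𝕜] {n m p : ℕ} (hn : 0 < n)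
    (F : Matrix (Fin n) (Fin n) 𝕜) (G : Matrix (Fin n) (Fin m) 𝕜)
    (H : Matrix (Fin p) (Fin n) 𝕜)
    (hstable : IsStable F) (hmin : IsMinimal F G H) :
    -- the Gramian equations are uniquely solvable, and `T` exists as a bounded operator
    (∃! Z : Matrix (Fin n) (Fin n) 𝕜, Z = Fᴴ * Z * F + Hᴴ * H) ∧
    (∃! P : Matrix (Fin n) (Fin n) 𝕜, P = F * P * Fᴴ + G * Gᴴ) ∧
    (∃ T : Op 𝕜 m p, HasTransferFunction T (anticausalTransfer F G H)) ∧
    ∀ (Z P : Matrix (Fin n) (Fin n) 𝕜) (T : Op 𝕜 m p),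
      Z = Fᴴ * Z * F + Hᴴ * H →
      P = F * P * Fᴴ + G * Gᴴ →
      HasTransferFunction T (anticausalTransfer F G H) →
      IsStrictlyAnticausal T ∧
      ∃ γ : ℝ, 0 < γ ∧ IsMaxEigenvalue (Z * P) (γ ^ 2) ∧
        -- the optimal value of the Nehari problem, attained
        IsLeast {d : ℝ | ∃ L : Op 𝕜 m p, IsBlockToeplitz L ∧ IsCausal L ∧ d = ‖L - T‖ ^ 2}
          (γ ^ 2) ∧
        (∃! Zg : Matrix (Fin n) (Fin n) 𝕜, Zg = Fᴴ * Zg * F + (γ ^ 2)⁻¹ • (Hᴴ * H)) ∧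
        -- the explicit optimal solution
        ∀ Zg : Matrix (Fin n) (Fin n) 𝕜, Zg = Fᴴ * Zg * F + (γ ^ 2)⁻¹ • (Hᴴ * H) →
          IsUnit (1 - Fᴴ * Zg * F * P) →
          ∃ L : Op 𝕜 m p, IsCausal L ∧
            HasTransferFunction L (solutionTransfer F G H P Zg) ∧
            ‖L - T‖ ^ 2 = γ ^ 2 := by
  have hF := hstable.summable_pow
  have hF' := summable_pow_conjTranspose hF
  refine ⟨existsUnique_lyapunov hF _, ?_, ⟨toeplitzOp fun k => H * anticausalPow F k * G,
    hasTransferFunction_toeplitzOp (summable_mul_mul (summable_anticausalPow hF) _ _)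
      fun z hz => hasSum_anticausalTransfer hstable G H hz⟩, ?_⟩
  · simpa only [Matrix.conjTranspose_conjTranspose] using existsUnique_lyapunov hF' (G * Gᴴ)
  intro Z P T hZ hP hT
  have hTb : ∀ i j, block T i j = H * anticausalPow F (i - j) * G :=
    block_eq_of_hasSum hT fun z hz => hasSum_anticausalTransfer hstable G H hz
  have hZd := lyapunov_posDef hF hmin.2 hZ
  have hPd := lyapunov_posDef (Z := P) hF' hmin.1.isObservable
    (by simpa only [Matrix.conjTranspose_conjTranspose] using hP)
  refine ⟨fun i j hij => ?_, ?_⟩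
  · rw [hTb, anticausalPow, if_neg (by lia)]
    simp
  obtain ⟨γ, hγ, hmax, ⟨w, hw, hwe⟩, hR⟩ := exists_isMaxEigenvalue hn hZd hPd
  have hlower : ∀ L : Op 𝕜 m p, IsCausal L → γ ^ 2 ≤ ‖L - T‖ ^ 2 := fun L hL =>
    le_norm_error_sq hF hZ hPd hP hTb hL hw hwe
  refine ⟨γ, hγ, hmax, ⟨?_, ?_⟩, existsUnique_lyapunov hF _, fun Zg hZg hu => ?_⟩
  · obtain ⟨L, hL1, hL2, hL3⟩ := exists_optimal hγ.le fun c hc =>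
      exists_suboptimal hγ hc hstable hPd hZd hP hZ hR hTb
    exact ⟨L, hL1, hL2, le_antisymm (hlower L hL2) (pow_le_pow_left₀ (norm_nonneg _) hL3 2)⟩
  · rintro d ⟨L, -, hL, rfl⟩
    exact hlower L hL
  -- By linearity and uniqueness Z_γ = γ⁻²Z, so the semidefinite gap at the optimal level is the one
  -- needed; invertibility is now assumed instead of derived.
  · have hZgZ : Zg = (γ ^ 2)⁻¹ • Z := lyapunov_unique hF hZg (smul_lyapunov hZ _)
    open scoped ComplexOrder in
    have hZgs : Zg.PosSemidef := by rw [hZgZ]; exact hZd.posSemidef.smul (by positivity)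
    obtain ⟨L, hL1, hL2, hL3⟩ := exists_central (T := T) (by positivity : 0 < γ ^ 2) hstable hu
      hPd hP hZg hZgs (by rwa [hZgZ]) hTb
    exact ⟨L, hL1, hL2, le_antisymm hL3 (hlower L hL1)⟩
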